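/- Setting. Consider a sequence of Gaussian linear models $Y = X\beta + \varepsilon$, with $X$ a deterministic real $n\times p$ matrix, $\varepsilon$ a standard normal vector in $\mathbb R^n$, and $p\to\infty$ along the sequence; $n, X, \lambda, \pi_p$ may all change along the sequence. Write $\|X\|=\max_j\|X_{\cdot,j}\|_2$, $\overline\lambda=2\|X\|\sqrt{\log p}$, $S_\beta=\{i:\beta_i\ne0\}$, and $\beta_S=(\beta_i)_{i\in S}$. The prior $\Pi$ draws a dimension $s$ from a probability distribution $\pi_p$ on $\{0,\dots,p\}$, then $S\subset\{1,\dots,p\}$ uniformly among the sets with $|S|=s$, then $\beta_S$ from the density $\prod_{i\in S}\frac\lambda2e^{-\lambda|\beta_i|}$, and sets $\beta_{S^c}=0$. The posterior is $\Pi(B\mid Y)=\int_Be^{-\|Y-X\beta\|_2^2/2}\,d\Pi(\beta)\big/\int e^{-\|Y-X\beta\|_2^2/2}\,d\Pi(\beta)$. Assume that $\lambda>0$ and $$\|X\|/p\le\lambda\le2\overline\lambda,\qquad A_1p^{-A_3}\pi_p(s-1)\le\pi_p(s)\le A_2p^{-A_4}\pi_p(s-1)\quad(s=1,\dots,p)$$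 for fixed constants $A_1,A_2,A_3,A_4>0$. Define (an infimum over the empty set being $\infty$) $$\phi(S)=\inf\Big\{\tfrac{\|X\beta\|_2|S|^{1/2}}{\|X\|\,\|\beta_S\|_1}:\|\beta_{S^c}\|_1\le7\|\beta_S\|_1,\ \beta_S\ne0\Big\},\qquad \overline\phi(s)=\inf\Big\{\tfrac{\|X\beta\|_2|S_\beta|^{1/2}}{\|X\|\,\|\beta\|_1}:0\ne|S_\beta|\le s\Big\},$$ $$\overline\psi(S)=\overline\phi\Big(\Big(2+\tfrac3{A_4}+\tfrac{33}{\phi(S)^2}\tfrac{\lambda}{\overline\lambda}\Big)|S|\Big).$$ For a true parameter $\beta^0$ with support $S_0=S_{\beta^0}$ and constants $\kappa, M$ let $$\mathcal S_0=\Big\{S:|S|\le\kappa|S_0|,\ \|\beta^0_{S^c}\|_1\le M|S_0|\sqrt{\log p}/\|X\|\Big\},\qquad \Pi^\infty(\cdot\mid Y)=\sum_{S\in\mathcal S_0}\widehat w_S\,\mathcal N\big(\widehat\beta_{(S)},(X_S^tX_S)^{-1}\big)\otimes\delta_{S^c},$$ where $X_S$ consists of the columns of $X$ with index in $S$, $\widehat\beta_{(S)}\in\operatorname{argmin}_{\beta_S}\|Y-X_S\beta_S\|_2^2$,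 $\delta_{S^c}$ is the point mass at $0\in\mathbb R^{S^c}$, and the weights $\widehat w_S$ are nonnegative, sum to one over $\mathcal S_0$, and satisfy $$\widehat w_S\propto\frac{\pi_p(|S|)}{\binom p{|S|}}\Big(\frac\lambda2\Big)^{|S|}(2\pi)^{|S|/2}\,|X_S^tX_S|^{-1/2}\,e^{\frac12\|X_S\widehat\beta_{(S)}\|_2^2}.$$ Theorem 6 (Bernstein–von Mises, small lambda regime). Let $c_0>0$ and $\kappa\ge1+3/A_4$. For every sufficiently large $M$ (how large depends only on $A_1,\dots,A_4,c_0,\kappa$) and every $s_n$ with $s_n\lambda\sqrt{\log p}/\|X\|\to0$, $$\sup_{\beta^0}\ \mathbb E_{\beta^0}\big\|\Pi(\cdot\mid Y)-\Pi^\infty(\cdot\mid Y)\big\|_{TV}\to0,$$ where the supremum is over all $\beta^0\in\mathbb R^p$ with $\phi(S_0)\ge c_0$, $|S_0|\le s_n$, $\overline\psi(S_0)\ge c_0$ and $\overline\phi((1+\kappa)|S_0|)\ge c_0$. For $\kappa=1+3/A_4$ the last condition is implied by $\overline\psi(S_0)\ge c_0$. The choice $\kappa=2+4/A_4$ is also allowed.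 -/

import Mathlib

open MeasureTheory ProbabilityTheory Filter Topology
open scoped ENNReal Matrix

noncomputable section

namespace SparseRegression

/-- `X β` as a vector of Euclidean space. -/
def apply {ι κ : Type*} [Fintype ι] (X : Matrix κ ι ℝ) (b : EuclideanSpace ℝ ι) :
    EuclideanSpace ℝ κ :=
  WithLp.toLp 2 (X *ᵥ b.ofLp)

/-- The norm `‖X‖`: the largest Euclidean length of a column of `X`. -/
def colNorm {n p : ℕ} (X : Matrix (Fin n) (Fin p) ℝ) : ℝ :=
  ⨆ j : Fin p, Real.sqrt (∑ i, X i j ^ 2)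

/-- The support `S_β = {i : β_i ≠ 0}`. -/
def supp {p : ℕ} (b : EuclideanSpace ℝ (Fin p)) : Finset (Fin p) :=
  Finset.univ.filter fun i => b i ≠ 0

/-- `‖β_S‖₁ = ∑_{i ∈ S} |β_i|`. -/
def l1On {p : ℕ} (S : Finset (Fin p)) (b : EuclideanSpace ℝ (Fin p)) : ℝ :=
  ∑ i ∈ S, |b i|

/-- `λ̄ = 2 ‖X‖ √(log p)`. -/
def lamBar {n p : ℕ} (X : Matrix (Fin n) (Fin p) ℝ) : ℝ :=
  2 * colNorm X * Real.sqrt (Real.log p)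

/-! ### Compatibility numbers

They are `[0, ∞]`-valued, so that an infimum over the empty set is `∞`. -/

/-- The compatibility number `φ(S)`: the infimum of `‖Xβ‖₂ |S|^{1/2} / (‖X‖ ‖β_S‖₁)` over all
`β` with `‖β_{Sᶜ}‖₁ ≤ 7 ‖β_S‖₁` and `β_S ≠ 0`. -/
def compat {n p : ℕ} (X : Matrix (Fin n) (Fin p) ℝ) (S : Finset (Fin p)) : ℝ≥0∞ :=
  ⨅ (b : EuclideanSpace ℝ (Fin p)) (_ : l1On Sᶜ b ≤ 7 * l1On S b ∧ ∃ i ∈ S, b i ≠ 0),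
    ENNReal.ofReal (‖apply X b‖ * Real.sqrt S.card / (colNorm X * l1On S b))

/-- The uniform compatibility number `φ̄(s)`: the infimum of `‖Xβ‖₂ |S_β|^{1/2} / (‖X‖ ‖β‖₁)`
over all `β` with `0 ≠ |S_β| ≤ s`. -/
def unifCompat {n p : ℕ} (X : Matrix (Fin n) (Fin p) ℝ) (s : ℝ≥0∞) : ℝ≥0∞ :=
  ⨅ (b : EuclideanSpace ℝ (Fin p)) (_ : (supp b).card ≠ 0 ∧ ((supp b).card : ℝ≥0∞) ≤ s),
    ENNReal.ofReal
      (‖apply X b‖ * Real.sqrt (supp b).card / (colNorm X * l1On Finset.univ b))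

/-- `ψ̄(S) = φ̄((2 + 3/A₄ + (33/φ(S)²) (λ/λ̄)) |S|)`. -/
def psiBar {n p : ℕ} (X : Matrix (Fin n) (Fin p) ℝ) (A₄ lam : ℝ) (S : Finset (Fin p)) : ℝ≥0∞ :=
  unifCompat X
    ((2 + ENNReal.ofReal (3 / A₄) + 33 / compat X S ^ 2 * ENNReal.ofReal (lam / lamBar X))
      * (S.card : ℝ≥0∞))

/-! ### Prior and posterior -/

/-- `pr 0, …, pr p` are the weights of a probability distribution on `{0, …, p}`. -/
def IsDimPrior (p : ℕ) (pr : ℕ → ℝ) : Prop :=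
  (∀ s ≤ p, 0 ≤ pr s) ∧ ∑ s ∈ Finset.range (p + 1), pr s = 1

/-- `A₁ p^{-A₃} π_p(s-1) ≤ π_p(s) ≤ A₂ p^{-A₄} π_p(s-1)` for `s = 1, …, p`. -/
def DimPriorDecay (A₁ A₂ A₃ A₄ : ℝ) (p : ℕ) (pr : ℕ → ℝ) : Prop :=
  ∀ s, 1 ≤ s → s ≤ p →
    A₁ * (p : ℝ) ^ (-A₃) * pr (s - 1) ≤ pr s ∧ pr s ≤ A₂ * (p : ℝ) ^ (-A₄) * pr (s - 1)

/-- The embedding `β_S ↦ (β_S, 0_{Sᶜ})` of `ℝ^S` into `ℝ^p`. The image of a measure `μ` under it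
is `μ ⊗ δ_0` on `ℝ^S × ℝ^{Sᶜ}`. -/
def embed {p : ℕ} (S : Finset (Fin p)) (b : EuclideanSpace ℝ S) : EuclideanSpace ℝ (Fin p) :=
  WithLp.toLp 2 fun i => if h : i ∈ S then b ⟨i, h⟩ else 0

/-- The distribution on `ℝ^S` with the product Laplace density `∏_{i ∈ S} (λ/2) e^{-λ |β_i|}`. -/
def laplace {p : ℕ} (lam : ℝ) (S : Finset (Fin p)) : Measure (EuclideanSpace ℝ S) :=
  volume.withDensity fun b => ENNReal.ofReal (∏ i, lam / 2 * Real.exp (-lam * |b i|))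

/-- The prior `Π`: the mixture over all models `S`, with weights `π_p(|S|) / (p choose |S|)`, of
the product Laplace distribution on `ℝ^S` and the point mass at `0` on `ℝ^{Sᶜ}`. -/
def prior (p : ℕ) (lam : ℝ) (pr : ℕ → ℝ) : Measure (EuclideanSpace ℝ (Fin p)) :=
  ∑ S : Finset (Fin p),
    ENNReal.ofReal (pr S.card / (p.choose S.card : ℝ)) • (laplace lam S).map (embed S)

/-- The likelihood `e^{-‖Y - Xβ‖²/2}`, up to a constant that cancels in the posterior. -/
def likelihood {n p : ℕ} (X : Matrix (Fin n) (Fin p) ℝ) (Y : EuclideanSpace ℝ (Fin n))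
    (b : EuclideanSpace ℝ (Fin p)) : ℝ≥0∞ :=
  ENNReal.ofReal (Real.exp (-‖Y - apply X b‖ ^ 2 / 2))

/-- The posterior distribution `Π(· | Y)`, by Bayes's formula. -/
def posterior {n p : ℕ} (X : Matrix (Fin n) (Fin p) ℝ) (lam : ℝ) (pr : ℕ → ℝ)
    (Y : EuclideanSpace ℝ (Fin n)) : Measure (EuclideanSpace ℝ (Fin p)) :=
  (∫⁻ b, likelihood X Y b ∂prior p lam pr)⁻¹ • (prior p lam pr).withDensity (likelihood X Y)

/-- The law of `Y = Xβ + ε`, where `ε` is a standard normal vector. -/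
def dataLaw {n p : ℕ} (X : Matrix (Fin n) (Fin p) ℝ) (b : EuclideanSpace ℝ (Fin p)) :
    Measure (EuclideanSpace ℝ (Fin n)) :=
  multivariateGaussian (apply X b) 1

/-! ### The approximating mixture -/

/-- The submatrix `X_S` of the columns of `X` with index in `S`. -/
def cols {n p : ℕ} (X : Matrix (Fin n) (Fin p) ℝ) (S : Finset (Fin p)) : Matrix (Fin n) S ℝ :=
  X.submatrix id Subtype.val

/-- The Gram matrix `X_Sᵗ X_S`. -/
def gram {n p : ℕ} (X : Matrix (Fin n) (Fin p) ℝ) (S : Finset (Fin p)) : Matrix S S ℝ :=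
  (cols X S)ᵀ * cols X S

/-- A least squares estimator `β̂_(S)`: a minimizer of `β_S ↦ ‖Y - X_S β_S‖₂` (it is unique when
`X_Sᵗ X_S` is invertible). -/
def leastSquares {n p : ℕ} (X : Matrix (Fin n) (Fin p) ℝ) (S : Finset (Fin p))
    (Y : EuclideanSpace ℝ (Fin n)) : EuclideanSpace ℝ S :=
  Classical.epsilon fun b =>
    ∀ b' : EuclideanSpace ℝ S, ‖Y - apply (cols X S) b‖ ≤ ‖Y - apply (cols X S) b'‖

/-- The neighbourhood `𝒮₀` of the support of `β⁰`: all models `S` with `|S| ≤ κ |S_{β⁰}|` and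
`‖β⁰_{Sᶜ}‖₁ ≤ M |S_{β⁰}| √(log p) / ‖X‖`. -/
def nbhdModels {n p : ℕ} (X : Matrix (Fin n) (Fin p) ℝ) (κ M : ℝ)
    (b₀ : EuclideanSpace ℝ (Fin p)) : Finset (Finset (Fin p)) :=
  Finset.univ.filter fun S =>
    (S.card : ℝ) ≤ κ * (supp b₀).card ∧
      l1On Sᶜ b₀ ≤ M * (supp b₀).card * Real.sqrt (Real.log p) / colNorm X

/-- The unnormalized weight of the model `S`. -/
def rawWeight {n p : ℕ} (X : Matrix (Fin n) (Fin p) ℝ) (lam : ℝ) (pr : ℕ → ℝ)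
    (Y : EuclideanSpace ℝ (Fin n)) (S : Finset (Fin p)) : ℝ :=
  pr S.card / (p.choose S.card : ℝ) * (lam / 2) ^ S.card
    * (2 * Real.pi) ^ ((S.card : ℝ) / 2) * (gram X S).det ^ (-(1 / 2) : ℝ)
    * Real.exp (1 / 2 * ‖apply (cols X S) (leastSquares X S Y)‖ ^ 2)

/-- The mixture `Π^∞(· | Y) = ∑_{S ∈ 𝒮₀} ŵ_S N(β̂_(S), (X_Sᵗ X_S)⁻¹) ⊗ δ_{Sᶜ}`. -/
def limitPosterior {n p : ℕ} (X : Matrix (Fin n) (Fin p) ℝ) (lam : ℝ) (pr : ℕ → ℝ)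
    (κ M : ℝ) (b₀ : EuclideanSpace ℝ (Fin p)) (Y : EuclideanSpace ℝ (Fin n)) :
    Measure (EuclideanSpace ℝ (Fin p)) :=
  ∑ S ∈ nbhdModels X κ M b₀,
    ENNReal.ofReal
        (rawWeight X lam pr Y S / ∑ S' ∈ nbhdModels X κ M b₀, rawWeight X lam pr Y S') •
      (multivariateGaussian (leastSquares X S Y) (gram X S)⁻¹).map (embed S)

/-- The total variation distance `sup_B |μ(B) - ν(B)|` of two probability measures. -/
def tvDist {α : Type*} [MeasurableSpace α] (μ ν : Measure α) : ℝ≥0∞ :=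
  ⨆ (B : Set α) (_ : MeasurableSet B), ENNReal.ofReal |μ.real B - ν.real B|

end SparseRegression

end

/-! Posterior and limit are normalized mixtures over the models `S` with the same weights
`modelWeight`. After division by the density at `b₀`, both integrate `relDensity` over Lebesgue
measure on the model; they differ only in the penalty rate, `t = lam` against `t = 0`, and in the
range of models (`posterior_apply`, `limitPosterior_apply`; the latter rests on completing the
square). So it must be shown that the posterior ignores the models outside the neighbourhood, and
that the penalty is nearly constant where the mass sits.

Normalizing constants: restricting to a small cube around `b₀` in the true model, where the noise
enters through an odd linear form, gives a lower bound `massLowerBound` of order `pr s₀ * (e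
p²)^(-s₀)` for every noise vector, `s₀` being the size of the true support (`massLowerBound_le`).

Large models, `|S| > κ s₀`: a fraction of the noise term is bounded by its maximum over the columns
and the rest is integrated by the Gaussian moment generating function. The compatibility number of
the true support then bounds the expected mass of a model by a Laplace integral
(`lintegral_modelMass_le`), and the decay of the prior on the dimension beats the lower bound
(`sum_large_le`).

Small models: vectors at `ℓ¹` distance more than `M s₀ √(log p) / ‖X‖` from `b₀` are negligible for
both rates, because uniform compatibility makes the quadratic term dominate noise and penalty
(`sum_modelMass_farSet_le`). A small model outside the neighbourhood consists of such vectors only.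
On the remaining vectors the penalty varies by a factor at most `e^(M δ)`, where `δ` bounds `s₀ λ
√(log p) / ‖X‖` and tends to zero. `tvDist_posterior_limit_le` combines these for fixed noise, and
`lintegral_tvDist_le` takes the expectation. -/

noncomputable section

namespace SparseRegression

/-! ### Integrals over Euclidean space -/

section Integrals

variable {ι : Type*} [Fintype ι]

lemma integral_exp_neg_mul_abs {a : ℝ} (ha : 0 < a) :
    ∫ x : ℝ, Real.exp (-(a * |x|)) = 2 / a := by
  have h := integral_comp_abs (f := fun x => Real.exp (-(a * x)))
  have h2 := integral_exp_mul_Ioi (a := -a) (by linarith) 0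
  simp only [neg_mul] at h2
  rw [h, h2]
  field_simp
  simp

lemma integrable_exp_neg_mul_abs {a : ℝ} (ha : 0 < a) :
    Integrable fun x : ℝ => Real.exp (-(a * |x|)) := by
  -- The integral of a non-integrable function is `0` by convention, so a nonzero value proves
  -- integrability.
  by_contra h
  have := integral_exp_neg_mul_abs ha
  rw [integral_undef h] at this
  have : 0 < 2 / a := by positivity
  linarith

/-- The mass of the unnormalized product Laplace density. -/
lemma lintegral_exp_neg_l1 {a : ℝ} (ha : 0 < a) :
    ∫⁻ b : EuclideanSpace ℝ ι, ENNReal.ofReal (Real.exp (-(a * ∑ i, |b i|)))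
      = ENNReal.ofReal ((2 / a) ^ Fintype.card ι) := by
  have hmeas : Measurable fun b : ι → ℝ => ENNReal.ofReal (Real.exp (-(a * ∑ i, |b i|))) := by
    fun_prop
  have h1 := (PiLp.volume_preserving_ofLp ι).lintegral_comp hmeas
  rw [h1]
  have hprod : (fun b : ι → ℝ => Real.exp (-(a * ∑ i, |b i|)))
      = fun b => ∏ i, Real.exp (-(a * |b i|)) := by
    funext b
    rw [← Real.exp_sum, Finset.mul_sum, Finset.sum_neg_distrib]
  have hint : Integrable fun b : ι → ℝ => Real.exp (-(a * ∑ i, |b i|)) := by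
    rw [hprod]
    exact Integrable.fintype_prod (f := fun _ x => Real.exp (-(a * |x|)))
      fun _ => integrable_exp_neg_mul_abs ha
  rw [← ofReal_integral_eq_lintegral_ofReal hint (ae_of_all _ fun _ => (Real.exp_pos _).le)]
  congr 1
  rw [hprod, integral_fintype_prod_volume_eq_prod (f := fun (_ : ι) x => Real.exp (-(a * |x|)))]
  simp [integral_exp_neg_mul_abs ha, div_pow]

lemma volume_cube {r : ℝ} (hr : 0 ≤ r) :
    volume {b : EuclideanSpace ℝ ι | ∀ i, |b i| ≤ r}
      = ENNReal.ofReal ((2 * r) ^ Fintype.card ι) := by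
  rw [← Real.volume_pi_closedBall (0 : ι → ℝ) hr,
    ← (PiLp.volume_preserving_ofLp ι).measure_preimage
      Metric.isClosed_closedBall.measurableSet.nullMeasurableSet]
  congr 1
  ext b
  simp [pi_norm_le_iff_of_nonneg hr]

lemma measurableSet_cube (r : ℝ) : MeasurableSet {b : EuclideanSpace ℝ ι | ∀ i, |b i| ≤ r} := by
  rw [Set.ofPred_forall]
  exact MeasurableSet.iInter fun i => measurableSet_le (by fun_prop) (by fun_prop)

/-- The average of the exponential of an odd function over a symmetric set is at least one. -/
lemma volume_le_setLIntegral_exp_odd {Q : Set (EuclideanSpace ℝ ι)} (hQ : MeasurableSet Q)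
    (hsymm : ∀ b, b ∈ Q → -b ∈ Q) {L : EuclideanSpace ℝ ι → ℝ} (hL : Measurable L)
    (hodd : ∀ b, L (-b) = -L b) :
    volume Q ≤ ∫⁻ b in Q, ENNReal.ofReal (Real.exp (L b)) := by
  have hQneg : ∀ b, -b ∈ Q ↔ b ∈ Q := fun b => ⟨fun h => by simpa using hsymm _ h, hsymm b⟩
  set I := ∫⁻ b in Q, ENNReal.ofReal (Real.exp (L b)) with hI
  have hneg : ∫⁻ b in Q, ENNReal.ofReal (Real.exp (-L b)) = I := by
    rw [hI, ← lintegral_indicator hQ, ← lintegral_indicator hQ,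
      ← (Measure.measurePreserving_neg (volume : Measure (EuclideanSpace ℝ ι))).lintegral_comp
        (by exact Measurable.indicator (by fun_prop) hQ)]
    refine lintegral_congr fun b => ?_
    by_cases hb : b ∈ Q
    · simp [Set.indicator, hb, (hQneg b).2 hb, hodd]
    · have : -b ∉ Q := fun h => hb ((hQneg b).1 h)
      simp [Set.indicator, hb, this]
  have h2 : 2 * volume Q ≤ 2 * I := by
    calc 2 * volume Q = ∫⁻ _ in Q, 2 := by simp
      _ ≤ ∫⁻ b in Q, (ENNReal.ofReal (Real.exp (L b)) + ENNReal.ofReal (Real.exp (-L b))) := by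
        refine lintegral_mono fun b => ?_
        rw [← ENNReal.ofReal_add (Real.exp_pos _).le (Real.exp_pos _).le]
        rw [show (2 : ℝ≥0∞) = ENNReal.ofReal 2 by simp]
        apply ENNReal.ofReal_le_ofReal
        -- Adding `1 + x ≤ e^x` at `x = L b` and `x = -L b` gives `2 ≤ e^L + e^(-L)`; by symmetry
        -- both terms have the same integral.
        have h1 := Real.add_one_le_exp (L b)
        have h2 := Real.add_one_le_exp (-L b)
        linarith
      _ = 2 * I := by
        rw [lintegral_add_left (by fun_prop), hneg, two_mul]
  exact (ENNReal.mul_le_mul_iff_right (by simp) (by simp)).1 h2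

end Integrals

/-! ### Gaussian measures -/

section Gaussian

variable {ι : Type*} [Fintype ι]

lemma lintegral_exp_neg_half_sq :
    ∫⁻ z : EuclideanSpace ℝ ι, ENNReal.ofReal (Real.exp (-‖z‖ ^ 2 / 2))
      = ENNReal.ofReal ((2 * Real.pi) ^ ((Fintype.card ι : ℝ) / 2)) := by
  have h := GaussianFourier.integral_rexp_neg_mul_sq_norm (V := EuclideanSpace ℝ ι)
    (b := 1 / 2) (by norm_num)
  have hfun : (fun z : EuclideanSpace ℝ ι => Real.exp (-‖z‖ ^ 2 / 2))
      = fun z => Real.exp (-(1 / 2) * ‖z‖ ^ 2) := by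
    funext z; congr 1; ring
  have hpos : 0 < (Real.pi / (1 / 2)) ^ ((Module.finrank ℝ (EuclideanSpace ℝ ι) : ℝ) / 2) := by
    positivity
  rw [← ofReal_integral_eq_lintegral_ofReal ?_ (ae_of_all _ fun _ => (Real.exp_pos _).le), hfun, h]
  · simp [mul_comm]
  · rw [hfun]
    by_contra hc
    rw [integral_undef hc] at h
    linarith

/-- The density of the standard normal distribution. -/
lemma stdGaussian_eq_withDensity :
    stdGaussian (EuclideanSpace ℝ ι) = volume.withDensity fun z =>
      ENNReal.ofReal ((2 * Real.pi) ^ (-((Fintype.card ι : ℝ) / 2))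
        * Real.exp (-‖z‖ ^ 2 / 2)) := by
  have hmeas : Measurable fun z : EuclideanSpace ℝ ι =>
      Real.toNNReal ((2 * Real.pi) ^ (-((Fintype.card ι : ℝ) / 2)) * Real.exp (-‖z‖ ^ 2 / 2)) := by
    fun_prop
  have hc : 0 ≤ (2 * Real.pi) ^ (-((Fintype.card ι : ℝ) / 2)) := by positivity
  have hfin : IsFiniteMeasure ((volume : Measure (EuclideanSpace ℝ ι)).withDensity fun z =>
      ENNReal.ofReal ((2 * Real.pi) ^ (-((Fintype.card ι : ℝ) / 2))
        * Real.exp (-‖z‖ ^ 2 / 2))) := by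
    refine isFiniteMeasure_withDensity ?_
    simp_rw [ENNReal.ofReal_mul hc]
    rw [lintegral_const_mul _ (by fun_prop), lintegral_exp_neg_half_sq]
    exact ENNReal.mul_ne_top ENNReal.ofReal_ne_top ENNReal.ofReal_ne_top
  -- Finite measures with equal characteristic functions agree; for the density it is a Gaussian
  -- Fourier integral.
  refine Measure.ext_of_charFun ?_
  funext t
  rw [charFun_stdGaussian, charFun_apply]
  have hd := integral_withDensity_eq_integral_smul (μ := (volume : Measure (EuclideanSpace ℝ ι)))
    hmeas (fun z => Complex.exp (inner ℝ z t * Complex.I))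
  have hg := GaussianFourier.integral_cexp_neg_mul_sq_norm_add (V := EuclideanSpace ℝ ι)
    (b := 1 / 2) (by norm_num) Complex.I t
  refine Eq.trans ?_ hd.symm
  have hfun : (fun z : EuclideanSpace ℝ ι =>
      Real.toNNReal ((2 * Real.pi) ^ (-((Fintype.card ι : ℝ) / 2)) * Real.exp (-‖z‖ ^ 2 / 2))
        • Complex.exp (inner ℝ z t * Complex.I))
      = fun z => (((2 * Real.pi) ^ (-((Fintype.card ι : ℝ) / 2)) : ℝ) : ℂ)
        * Complex.exp (-(1 / 2) * ‖z‖ ^ 2 + Complex.I * inner ℝ t z) := by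
    funext z
    rw [NNReal.smul_def, Real.coe_toNNReal _ (by positivity), real_inner_comm, Complex.real_smul]
    push_cast
    rw [mul_assoc, ← Complex.exp_add]
    congr 2
    ring
  rw [hfun, integral_const_mul, hg, ← mul_assoc]
  have h1 : (Real.pi / (1 / 2) : ℂ) = ((2 * Real.pi : ℝ) : ℂ) := by push_cast; ring
  rw [h1, finrank_euclideanSpace]
  have h2 : (((2 * Real.pi : ℝ) : ℂ)) ^ ((Fintype.card ι : ℂ) / 2)
      = (((2 * Real.pi) ^ ((Fintype.card ι : ℝ) / 2) : ℝ) : ℂ) := by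
    rw [Complex.ofReal_cpow (by positivity)]
    push_cast; rfl
  rw [h2, ← Complex.ofReal_mul, ← Real.rpow_add (by positivity)]
  simp only [neg_add_cancel, Real.rpow_zero, Complex.ofReal_one, one_mul, Complex.I_sq]
  congr 1
  ring

/-- The moment generating function of the standard normal distribution. -/
lemma lintegral_exp_inner_stdGaussian (v : EuclideanSpace ℝ ι) :
    ∫⁻ z, ENNReal.ofReal (Real.exp (inner ℝ v z)) ∂(stdGaussian (EuclideanSpace ℝ ι))
      = ENNReal.ofReal (Real.exp (‖v‖ ^ 2 / 2)) := by
  have hmap := IsGaussian.map_eq_gaussianReal (μ := stdGaussian (EuclideanSpace ℝ ι))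
    (innerSL ℝ v)
  have hvar : Var[(innerSL ℝ v); stdGaussian (EuclideanSpace ℝ ι)] = ‖v‖ ^ 2 := by
    rw [variance_dual_stdGaussian, innerSL_apply_norm]
  rw [integral_strongDual_stdGaussian, hvar] at hmap
  have hmgf := mgf_gaussianReal hmap 1
  have hpos : mgf (innerSL ℝ v) (stdGaussian (EuclideanSpace ℝ ι)) 1 = Real.exp (‖v‖ ^ 2 / 2) := by
    rw [hmgf, Real.coe_toNNReal _ (by positivity)]; simp
  rw [mgf] at hpos
  simp only [one_mul, innerSL_apply_apply] at hpos
  rw [← hpos, ofReal_integral_eq_lintegral_ofReal ?_ (ae_of_all _ fun _ => (Real.exp_pos _).le)]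
  by_contra hc
  rw [integral_undef hc] at hpos
  exact (Real.exp_pos _).ne hpos

end Gaussian

/-! ### Total variation distance -/

section TotalVariation

variable {α : Type*} [MeasurableSpace α] {P Q : Measure α}

lemma tvDist_le_one [IsProbabilityMeasure P] [IsProbabilityMeasure Q] : tvDist P Q ≤ 1 := by
  refine iSup₂_le fun B _ => ENNReal.ofReal_le_one.2 ?_
  have h1 := measureReal_nonneg (μ := P) (s := B)
  have h2 := measureReal_nonneg (μ := Q) (s := B)
  have h3 := measureReal_le_one (μ := P) (s := B)
  have h4 := measureReal_le_one (μ := Q) (s := B)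
  exact abs_le.2 ⟨by linarith, by linarith⟩

/-- A one-sided comparison suffices: for probability measures the bound on the complement of `B` is
the reverse bound on `B`. -/
lemma tvDist_le_of_forall_le [IsProbabilityMeasure P] [IsProbabilityMeasure Q] {η k : ℝ≥0∞}
    (h : ∀ B, MeasurableSet B → P B ≤ η + (1 + k) * Q B) : tvDist P Q ≤ η + k := by
  by_cases htop : η + k = ∞
  · simp [htop]
  obtain ⟨hη, hk⟩ := ENNReal.add_ne_top.1 htop
  have key : ∀ B, MeasurableSet B → P.real B ≤ η.toReal + k.toReal + Q.real B := by
    intro B hB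
    have h1 : P B ≤ η + k + Q B := by
      refine (h B hB).trans ?_
      rw [add_mul, one_mul, add_assoc, add_comm (Q B)]
      gcongr
      exact mul_le_of_le_one_right' prob_le_one
    have h2 := ENNReal.toReal_mono (ENNReal.add_ne_top.2 ⟨htop, measure_ne_top _ _⟩) h1
    rwa [ENNReal.toReal_add htop (measure_ne_top _ _), ENNReal.toReal_add hη hk] at h2
  refine iSup₂_le fun B hB => ?_
  rw [← ENNReal.ofReal_toReal htop, ENNReal.toReal_add hη hk]
  apply ENNReal.ofReal_le_ofReal
  have h1 := key B hB
  have h2 := key Bᶜ hB.compl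
  rw [probReal_compl_eq_one_sub hB, probReal_compl_eq_one_sub hB] at h2
  exact abs_le.2 ⟨by linarith, by linarith⟩

end TotalVariation

/-! ### The linear map of a design matrix -/

section ApplyLin

variable {ι κ : Type*} [Fintype ι]

/-- The map `apply Z` as a linear map. -/
def applyLin (Z : Matrix κ ι ℝ) : EuclideanSpace ℝ ι →ₗ[ℝ] EuclideanSpace ℝ κ where
  toFun := apply Z
  map_add' a b := by simp [apply, Matrix.mulVec_add]
  map_smul' c a := by simp [apply, Matrix.mulVec_smul]

@[simp]
lemma applyLin_apply (Z : Matrix κ ι ℝ) (b : EuclideanSpace ℝ ι) : applyLin Z b = apply Z b := rfl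

lemma apply_sub (Z : Matrix κ ι ℝ) (a b : EuclideanSpace ℝ ι) :
    apply Z (a - b) = apply Z a - apply Z b := map_sub (applyLin Z) a b

lemma apply_neg (Z : Matrix κ ι ℝ) (a : EuclideanSpace ℝ ι) :
    apply Z (-a) = -apply Z a := map_neg (applyLin Z) a

@[fun_prop]
lemma continuous_apply [Fintype κ] (Z : Matrix κ ι ℝ) : Continuous (apply Z) :=
  (applyLin Z).continuous_of_finiteDimensional

@[fun_prop]
lemma measurable_apply [Fintype κ] (Z : Matrix κ ι ℝ) : Measurable (apply Z) :=
  (continuous_apply Z).measurable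

lemma norm_apply_sq [Fintype κ] (Z : Matrix κ ι ℝ) (v : EuclideanSpace ℝ ι) :
    ‖apply Z v‖ ^ 2 = v.ofLp ⬝ᵥ (Zᵀ * Z) *ᵥ v.ofLp := by
  rw [EuclideanSpace.real_norm_sq_eq, ← Matrix.mulVec_mulVec, Matrix.dotProduct_mulVec,
    Matrix.vecMul_transpose]
  simp [apply, dotProduct, sq]

end ApplyLin

/-! ### The multivariate normal distribution with invertible covariance matrix -/

section Density

variable {ι : Type*} [Fintype ι] [DecidableEq ι]

open scoped MatrixOrder in
-- The normal distribution is defined as the image of the standard one under `z ↦ m + A z` with `A`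
-- the square root of `G⁻¹`. The identity `A G A = 1` turns `‖z‖²` into the quadratic form of `G`,
-- and the Jacobian is `|det A|⁻¹ = (det G)^(1/2)`.
lemma lintegral_multivariateGaussian_inv {G : Matrix ι ι ℝ} (hG : G.PosDef)
    (m : EuclideanSpace ℝ ι) {g : EuclideanSpace ℝ ι → ℝ≥0∞} (hg : Measurable g) :
    ∫⁻ b, g b ∂(multivariateGaussian m G⁻¹)
      = ENNReal.ofReal ((2 * Real.pi) ^ (-((Fintype.card ι : ℝ) / 2)) * G.det ^ (1 / 2 : ℝ))
        * ∫⁻ b, g b * ENNReal.ofReal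
            (Real.exp (-((b - m).ofLp ⬝ᵥ G *ᵥ (b - m).ofLp) / 2)) := by
  set A := CFC.sqrt G⁻¹ with hA
  have hinv : G⁻¹.PosSemidef := hG.inv.posSemidef
  have hAA : A * A = G⁻¹ := CFC.sqrt_mul_sqrt_self _ hinv.nonneg
  have hAT : Aᵀ = A := by
    have h := (CFC.sqrt_nonneg G⁻¹).isSelfAdjoint
    rw [IsSelfAdjoint, Matrix.star_eq_conjTranspose, Matrix.conjTranspose_eq_transpose_of_trivial]
      at h
    exact h
  have hdetG : 0 < G.det := hG.det_pos
  have hunit : IsUnit G.det := hdetG.ne'.isUnit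
  -- A one-sided inverse of a square matrix is two-sided, so it is enough that `A * (A * G) = 1`.
  have hAGA : A * G * A = 1 := by
    rw [mul_eq_one_comm, ← mul_assoc, hAA, Matrix.nonsing_inv_mul _ hunit]
  have hdetsq : A.det * A.det = G.det⁻¹ := by
    rw [← Matrix.det_mul, hAA, Matrix.det_nonsing_inv, Ring.inverse_eq_inv']
  have hdetA : A.det ≠ 0 := by
    intro h0
    rw [h0, mul_zero] at hdetsq
    exact (inv_ne_zero hdetG.ne') hdetsq.symm
  have habs : |A.det⁻¹| = G.det ^ (1 / 2 : ℝ) := by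
    rw [← Real.sqrt_eq_rpow, ← Real.sqrt_sq_eq_abs]
    congr 1
    rw [inv_pow, sq, hdetsq, inv_inv]
  set f : EuclideanSpace ℝ ι →ₗ[ℝ] EuclideanSpace ℝ ι := Matrix.toLpLin 2 2 A with hf
  have hfapp : ∀ z, Matrix.toEuclideanCLM (𝕜 := ℝ) A z = f z := fun z => rfl
  have hfm : Measurable f := (f.continuous_of_finiteDimensional).measurable
  have hdetf : LinearMap.det f = A.det := LinearMap.det_toLpLin 2 A
  have hquad : ∀ z : EuclideanSpace ℝ ι, (f z).ofLp ⬝ᵥ G *ᵥ (f z).ofLp = ‖z‖ ^ 2 := by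
    intro z
    have h1 : (f z).ofLp = A *ᵥ z.ofLp := rfl
    rw [h1, Matrix.mulVec_mulVec, Matrix.dotProduct_mulVec, ← Matrix.vecMul_transpose,
      Matrix.vecMul_vecMul, hAT, ← mul_assoc, hAGA, Matrix.vecMul_one,
      EuclideanSpace.real_norm_sq_eq]
    simp [dotProduct, sq]
  set c : ℝ := (2 * Real.pi) ^ (-((Fintype.card ι : ℝ) / 2)) with hc
  have hc0 : 0 ≤ c := by positivity
  set h : EuclideanSpace ℝ ι → ℝ≥0∞ := fun b =>
    ENNReal.ofReal (c * Real.exp (-(b.ofLp ⬝ᵥ G *ᵥ b.ofLp) / 2)) * g (m + b) with hh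
  have hquadm : Measurable fun b : EuclideanSpace ℝ ι => b.ofLp ⬝ᵥ G *ᵥ b.ofLp := by
    simp only [dotProduct, Matrix.mulVec]
    fun_prop
  have hhm : Measurable h := by
    simp only [hh]
    fun_prop
  rw [multivariateGaussian, lintegral_map hg (by fun_prop), stdGaussian_eq_withDensity,
    lintegral_withDensity_eq_lintegral_mul _ (by fun_prop)
      (show Measurable fun x => g (m + Matrix.toEuclideanCLM (𝕜 := ℝ) A x) from
        hg.comp (by fun_prop))]
  have h1 : ∀ z : EuclideanSpace ℝ ι,
      ((fun z : EuclideanSpace ℝ ι => ENNReal.ofReal (c * Real.exp (-‖z‖ ^ 2 / 2)))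
        * (fun x : EuclideanSpace ℝ ι => g (m + Matrix.toEuclideanCLM (𝕜 := ℝ) A x))) z = h (f z) := by
    intro z
    simp only [hh, Pi.mul_apply, hquad, hfapp]
  rw [lintegral_congr h1, ← lintegral_map hhm hfm,
    Measure.map_linearMap_addHaar_eq_smul_addHaar _ (by rw [hdetf]; exact hdetA), hdetf, habs,
    lintegral_smul_measure, smul_eq_mul]
  have h2 : ∫⁻ b, h b = ENNReal.ofReal c * ∫⁻ b, g b * ENNReal.ofReal
            (Real.exp (-((b - m).ofLp ⬝ᵥ G *ᵥ (b - m).ofLp) / 2)) := by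
    rw [← lintegral_add_left_eq_self (fun b => g b * ENNReal.ofReal
        (Real.exp (-((b - m).ofLp ⬝ᵥ G *ᵥ (b - m).ofLp) / 2))) m, ← lintegral_const_mul _ (by fun_prop)]
    refine lintegral_congr fun b => ?_
    simp only [hh, add_sub_cancel_left]
    rw [ENNReal.ofReal_mul hc0, mul_assoc, mul_comm (ENNReal.ofReal (Real.exp _))]
  rw [h2, ← mul_assoc, ← ENNReal.ofReal_mul (by positivity), mul_comm c]

lemma dataLaw_eq_map {n p : ℕ} (X : Matrix (Fin n) (Fin p) ℝ) (b : EuclideanSpace ℝ (Fin p)) :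
    dataLaw X b = (stdGaussian (EuclideanSpace ℝ (Fin n))).map fun e => apply X b + e := by
  simp [dataLaw, multivariateGaussian]

end Density

/-! ### Least squares -/

section LeastSquares

variable {n p : ℕ} (X : Matrix (Fin n) (Fin p) ℝ) (S : Finset (Fin p))
  (Y : EuclideanSpace ℝ (Fin n))

/-- The normal equations. The estimator is a choice among minimizers, so existence is needed first:
it comes from projecting `Y` on the column space, and invertibility of the Gram matrix plays no
role. -/
lemma inner_sub_leastSquares (b : EuclideanSpace ℝ S) :
    inner ℝ (Y - apply (cols X S) (leastSquares X S Y)) (apply (cols X S) b) = 0 := by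
  set K := LinearMap.range (applyLin (cols X S)) with hK
  obtain ⟨v, hv, hmin⟩ := K.exists_norm_eq_iInf_of_complete_subspace
    (Submodule.complete_of_finiteDimensional K) Y
  obtain ⟨w, rfl⟩ := hv
  have hbdd : BddBelow (Set.range fun w : K => ‖Y - w‖) :=
    ⟨0, by rintro _ ⟨w, rfl⟩; exact norm_nonneg _⟩
  have hle : ∀ b' : EuclideanSpace ℝ S,
      ⨅ w : K, ‖Y - w‖ ≤ ‖Y - apply (cols X S) b'‖ := fun b' =>
    ciInf_le hbdd (⟨apply (cols X S) b', ⟨b', rfl⟩⟩ : K)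
  have hex : ∃ b : EuclideanSpace ℝ S, ∀ b' : EuclideanSpace ℝ S,
      ‖Y - apply (cols X S) b‖ ≤ ‖Y - apply (cols X S) b'‖ := by
    refine ⟨w, fun b' => ?_⟩
    rw [applyLin_apply] at hmin
    rw [hmin]
    exact hle b'
  have hspec := Classical.epsilon_spec hex
  change ∀ b', ‖Y - apply (cols X S) (leastSquares X S Y)‖ ≤ _ at hspec
  refine (K.norm_eq_iInf_iff_real_inner_eq_zero ⟨leastSquares X S Y, rfl⟩).1
    (le_antisymm (le_ciInf ?_) (hle _)) _ ⟨b, rfl⟩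
  rintro ⟨_, b', rfl⟩
  exact hspec b'

/-- Pythagoras, used twice. In `b`, the likelihood of a model is thus an unnormalized normal density
centred at the least squares estimator, with the Gram matrix as precision. -/
lemma norm_sub_apply_cols_sq (b : EuclideanSpace ℝ S) :
    ‖Y - apply (cols X S) b‖ ^ 2 = ‖Y‖ ^ 2 - ‖apply (cols X S) (leastSquares X S Y)‖ ^ 2
      + ‖apply (cols X S) (b - leastSquares X S Y)‖ ^ 2 := by
  set c := leastSquares X S Y with hc
  have h1 := inner_sub_leastSquares X S Y c
  have h2 := inner_sub_leastSquares X S Y (b - c)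
  rw [← hc] at h1 h2
  have e1 : Y = (Y - apply (cols X S) c) + apply (cols X S) c := by abel
  have e2 : Y - apply (cols X S) b
      = (Y - apply (cols X S) c) - apply (cols X S) (b - c) := by
    rw [apply_sub]; abel
  have n1 : ‖Y‖ ^ 2 = ‖Y - apply (cols X S) c‖ ^ 2 + ‖apply (cols X S) c‖ ^ 2 := by
    conv_lhs => rw [e1]
    rw [norm_add_sq_real, h1]; ring
  rw [e2, norm_sub_sq_real, h2, n1]; ring

end LeastSquares

/-! ### Embedding of a model -/

section Embed

variable {n p : ℕ} (S : Finset (Fin p))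

/-- The map `embed S` as a linear map. -/
def embedLin : EuclideanSpace ℝ S →ₗ[ℝ] EuclideanSpace ℝ (Fin p) where
  toFun := embed S
  map_add' a b := by
    ext i
    by_cases h : i ∈ S <;> simp [embed, h]
  map_smul' c a := by
    ext i
    by_cases h : i ∈ S <;> simp [embed, h]

@[fun_prop]
lemma measurable_embed : Measurable (embed S) :=
  ((embedLin S).continuous_of_finiteDimensional).measurable

lemma embed_add (a b : EuclideanSpace ℝ S) : embed S (a + b) = embed S a + embed S b :=
  map_add (embedLin S) a b

lemma embed_apply_of_mem (b : EuclideanSpace ℝ S) {i : Fin p} (h : i ∈ S) :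
    embed S b i = b ⟨i, h⟩ := by simp [embed, h]

lemma embed_apply_of_notMem (b : EuclideanSpace ℝ S) {i : Fin p} (h : i ∉ S) :
    embed S b i = 0 := by simp [embed, h]

lemma l1On_embed (b : EuclideanSpace ℝ S) : l1On Finset.univ (embed S b) = ∑ i, |b i| := by
  rw [l1On, ← Finset.sum_subset (Finset.subset_univ S), ← Finset.sum_coe_sort]
  · exact Finset.sum_congr rfl fun i _ => by rw [embed_apply_of_mem S b i.2]
  · intro i _ hi
    rw [embed_apply_of_notMem S b hi, abs_zero]

lemma apply_embed (X : Matrix (Fin n) (Fin p) ℝ) (b : EuclideanSpace ℝ S) :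
    apply X (embed S b) = apply (cols X S) b := by
  ext k
  simp only [apply, Matrix.mulVec, dotProduct, cols, Matrix.submatrix_apply, id_eq]
  rw [← Finset.sum_subset (Finset.subset_univ S), ← Finset.sum_coe_sort]
  · exact Finset.sum_congr rfl fun i _ => by
      have := embed_apply_of_mem S b i.2
      rw [this]
  · intro i _ hi
    have := embed_apply_of_notMem S b hi
    rw [this, mul_zero]

/-- The coordinates of a vector in `S`. -/
def coords (b : EuclideanSpace ℝ (Fin p)) : EuclideanSpace ℝ S := WithLp.toLp 2 fun i => b i

@[simp]
lemma coords_apply (b : EuclideanSpace ℝ (Fin p)) (i : S) : coords S b i = b i := rfl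

lemma supp_embed_subset (b : EuclideanSpace ℝ S) : supp (embed S b) ⊆ S := by
  intro i hi
  by_contra h
  exact (Finset.mem_filter.1 hi).2 (embed_apply_of_notMem S b h)

lemma embed_coords_supp (b : EuclideanSpace ℝ (Fin p)) :
    embed (supp b) (coords (supp b) b) = b := by
  ext i
  by_cases h : i ∈ supp b
  · rw [embed_apply_of_mem _ _ h, coords_apply]
  · rw [embed_apply_of_notMem _ _ h]
    simpa [supp, eq_comm] using h

@[fun_prop]
lemma measurable_l1On : Measurable (l1On S) := by
  unfold l1On
  fun_prop

end Embed

/-! ### Posterior and limit as normalized mixtures -/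

section Mixtures

variable {n p : ℕ} (X : Matrix (Fin n) (Fin p) ℝ) (b₀ : EuclideanSpace ℝ (Fin p))
  (e : EuclideanSpace ℝ (Fin n)) (lam : ℝ) (pr : ℕ → ℝ)

/-- Lebesgue measure on the model `S`. -/
def modelMeasure (S : Finset (Fin p)) : Measure (EuclideanSpace ℝ (Fin p)) :=
  volume.map (embed S)

/-- The prior weight of the model `S`, including the normalization of the Laplace density. -/
def modelWeight (S : Finset (Fin p)) : ℝ :=
  pr S.card / (p.choose S.card : ℝ) * (lam / 2) ^ S.card

/-- Likelihood times `e^{-t ‖β‖₁}`, relative to their values at `b₀`, in terms of the noise. -/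
def relDensity (t : ℝ) (b : EuclideanSpace ℝ (Fin p)) : ℝ :=
  Real.exp (inner ℝ e (apply X (b - b₀)) - ‖apply X (b - b₀)‖ ^ 2 / 2
    + t * (l1On Finset.univ b₀ - l1On Finset.univ b))

/-- The contribution of the model `S` to the mass of `B`. -/
def modelMass (t : ℝ) (S : Finset (Fin p)) (B : Set (EuclideanSpace ℝ (Fin p))) : ℝ≥0∞ :=
  ∫⁻ b in B, ENNReal.ofReal (relDensity X b₀ e t b) ∂(modelMeasure S)

@[fun_prop]
lemma measurable_relDensity (t : ℝ) : Measurable (relDensity X b₀ e t) := by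
  unfold relDensity
  have h : Measurable fun b : EuclideanSpace ℝ (Fin p) => apply X (b - b₀) :=
    (measurable_apply X).comp (by fun_prop)
  fun_prop

lemma modelMass_eq (t : ℝ) (S : Finset (Fin p)) {B : Set (EuclideanSpace ℝ (Fin p))}
    (hB : MeasurableSet B) :
    modelMass X b₀ e t S B
      = ∫⁻ b in embed S ⁻¹' B, ENNReal.ofReal (relDensity X b₀ e t (embed S b)) := by
  rw [modelMass, modelMeasure, setLIntegral_map hB (by fun_prop) (by fun_prop)]

/-- The factor in front of `relDensity` depends on neither `b` nor the model, so it cancels on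
normalization. -/
lemma exp_neg_norm_sub_sq (b : EuclideanSpace ℝ (Fin p)) (t : ℝ) :
    Real.exp (-‖apply X b₀ + e - apply X b‖ ^ 2 / 2)
        * Real.exp (-(t * l1On Finset.univ b))
      = Real.exp (-‖e‖ ^ 2 / 2 - t * l1On Finset.univ b₀) * relDensity X b₀ e t b := by
  have h : apply X b₀ + e - apply X b = e - apply X (b - b₀) := by
    rw [apply_sub]; abel
  rw [h, norm_sub_sq_real, relDensity, ← Real.exp_add, ← Real.exp_add]
  congr 1
  ring

lemma inv_mul_mul_cancel_left {K a b : ℝ≥0∞} (h0 : K ≠ 0) (ht : K ≠ ∞) :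
    (K * a)⁻¹ * (K * b) = a⁻¹ * b := by
  rw [ENNReal.mul_inv (Or.inl h0) (Or.inl ht), mul_mul_mul_comm, ENNReal.inv_mul_cancel h0 ht,
    one_mul]

lemma ofReal_exp_ne_zero (x : ℝ) : ENNReal.ofReal (Real.exp x) ≠ 0 := by
  simp [Real.exp_pos]

variable {lam pr}

lemma setLIntegral_likelihood_laplace (hlam : 0 < lam) (S : Finset (Fin p))
    {B : Set (EuclideanSpace ℝ (Fin p))} (hB : MeasurableSet B) :
    ∫⁻ b in B, likelihood X (apply X b₀ + e) b ∂((laplace lam S).map (embed S))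
      = ENNReal.ofReal (Real.exp (-‖e‖ ^ 2 / 2 - lam * l1On Finset.univ b₀))
        * (ENNReal.ofReal ((lam / 2) ^ S.card) * modelMass X b₀ e lam S B) := by
  have hlik : Measurable (likelihood X (apply X b₀ + e)) := by
    unfold likelihood
    fun_prop
  rw [setLIntegral_map hB hlik (by fun_prop), laplace,
    setLIntegral_withDensity_eq_setLIntegral_mul _ (by fun_prop)
      (show Measurable fun b => likelihood X (apply X b₀ + e) (embed S b) from
        hlik.comp (measurable_embed S)) (measurable_embed S hB),
    modelMass_eq _ _ _ _ _ hB, ← mul_assoc, ← lintegral_const_mul _ (by fun_prop)]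
  refine lintegral_congr fun b => ?_
  rw [Pi.mul_apply, likelihood, ← ENNReal.ofReal_mul (by positivity),
    ← ENNReal.ofReal_mul (by positivity), ← ENNReal.ofReal_mul (by positivity)]
  congr 1
  have h := exp_neg_norm_sub_sq X b₀ e (embed S b) lam
  rw [mul_right_comm, ← h, Finset.prod_mul_distrib, ← Real.exp_sum, l1On_embed, ← Finset.mul_sum]
  simp only [Finset.prod_const, Finset.card_univ, Fintype.card_coe, neg_mul]
  ring

lemma prior_withDensity_apply (hlam : 0 < lam) (hpr : ∀ s ≤ p, 0 ≤ pr s)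
    {B : Set (EuclideanSpace ℝ (Fin p))} (hB : MeasurableSet B) :
    ∫⁻ b in B, likelihood X (apply X b₀ + e) b ∂(prior p lam pr)
      = ENNReal.ofReal (Real.exp (-‖e‖ ^ 2 / 2 - lam * l1On Finset.univ b₀))
        * ∑ S, ENNReal.ofReal (modelWeight lam pr S) * modelMass X b₀ e lam S B := by
  rw [← lintegral_indicator hB, prior, lintegral_finsetSum_measure, Finset.mul_sum]
  refine Finset.sum_congr rfl fun S _ => ?_
  have h0 : 0 ≤ pr S.card / (p.choose S.card : ℝ) :=
    div_nonneg (hpr _ (by simpa using S.card_le_univ)) (by positivity)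
  rw [lintegral_smul_measure, smul_eq_mul, lintegral_indicator hB,
    setLIntegral_likelihood_laplace X b₀ e hlam S hB, modelWeight, ENNReal.ofReal_mul h0]
  ring

/-- The posterior distribution as a normalized mixture over models. -/
lemma posterior_apply (hlam : 0 < lam) (hpr : ∀ s ≤ p, 0 ≤ pr s)
    {B : Set (EuclideanSpace ℝ (Fin p))} (hB : MeasurableSet B) :
    posterior X lam pr (apply X b₀ + e) B
      = (∑ S, ENNReal.ofReal (modelWeight lam pr S) * modelMass X b₀ e lam S Set.univ)⁻¹
        * ∑ S, ENNReal.ofReal (modelWeight lam pr S) * modelMass X b₀ e lam S B := by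
  rw [posterior, Measure.smul_apply, smul_eq_mul, withDensity_apply _ hB,
    prior_withDensity_apply X b₀ e hlam hpr hB, ← setLIntegral_univ,
    prior_withDensity_apply X b₀ e hlam hpr MeasurableSet.univ,
    inv_mul_mul_cancel_left (ofReal_exp_ne_zero _) ENNReal.ofReal_ne_top]

lemma laplace_univ (hlam : 0 < lam) (S : Finset (Fin p)) : laplace lam S Set.univ = 1 := by
  rw [laplace, withDensity_apply _ MeasurableSet.univ, setLIntegral_univ]
  have h : ∀ b : EuclideanSpace ℝ S, ENNReal.ofReal (∏ i, lam / 2 * Real.exp (-lam * |b i|))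
      = ENNReal.ofReal ((lam / 2) ^ S.card)
        * ENNReal.ofReal (Real.exp (-(lam * ∑ i, |b i|))) := by
    intro b
    rw [← ENNReal.ofReal_mul (by positivity), Finset.prod_mul_distrib, ← Real.exp_sum,
      ← Finset.mul_sum]
    simp [div_pow]
  rw [lintegral_congr h, lintegral_const_mul _ (by fun_prop), lintegral_exp_neg_l1 hlam,
    ← ENNReal.ofReal_mul (by positivity)]
  rw [Fintype.card_coe, ← mul_pow, div_mul_div_cancel₀ (by norm_num), div_self hlam.ne']
  simp

/-- The likelihood is at most one and the prior has finite mass. -/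
lemma sum_modelMass_ne_top (hlam : 0 < lam) (hpr : ∀ s ≤ p, 0 ≤ pr s) :
    ∑ S, ENNReal.ofReal (modelWeight lam pr S) * modelMass X b₀ e lam S Set.univ ≠ ∞ := by
  have h := prior_withDensity_apply X b₀ e hlam hpr MeasurableSet.univ
  have hfin : ∫⁻ b in Set.univ, likelihood X (apply X b₀ + e) b ∂(prior p lam pr) ≠ ∞ := by
    refine ne_top_of_le_ne_top (b := prior p lam pr Set.univ) ?_ ?_
    · rw [prior, Measure.finsetSum_apply]
      refine ENNReal.sum_ne_top.2 fun S _ => ?_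
      rw [Measure.smul_apply, smul_eq_mul, Measure.map_apply (measurable_embed S) .univ,
        Set.preimage_univ, laplace_univ hlam, mul_one]
      exact ENNReal.ofReal_ne_top
    · calc _ ≤ ∫⁻ _ in Set.univ, 1 ∂(prior p lam pr) := by
            refine lintegral_mono fun b => ?_
            rw [likelihood]
            refine ENNReal.ofReal_le_one.2 (Real.exp_le_one_iff.2 ?_)
            have := sq_nonneg ‖apply X b₀ + e - apply X b‖
            linarith
        _ = _ := by simp
  intro htop
  rw [h, htop, ENNReal.mul_top (ofReal_exp_ne_zero _)] at hfin
  exact hfin rfl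

lemma isProbabilityMeasure_posterior (hlam : 0 < lam) (hpr : ∀ s ≤ p, 0 ≤ pr s)
    (h0 : ∑ S, ENNReal.ofReal (modelWeight lam pr S) * modelMass X b₀ e lam S Set.univ ≠ 0) :
    IsProbabilityMeasure (posterior X lam pr (apply X b₀ + e)) :=
  ⟨by rw [posterior_apply X b₀ e hlam hpr .univ,
    ENNReal.inv_mul_cancel h0 (sum_modelMass_ne_top X b₀ e hlam hpr)]⟩

/-- The powers of `2π` and of the determinant in the raw weight cancel the normalizing constant of
the normal density, and its exponential is what completing the square leaves over. Up to a factor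
free of `S`, the component is therefore the mass of the model with the penalty removed (`t = 0`),
while the prior factor `(lam / 2) ^ |S|` stays. -/
lemma ofReal_rawWeight_mul (hlam : 0 < lam) {S : Finset (Fin p)} (hpr : 0 ≤ pr S.card)
    (hG : (gram X S).PosDef) {B : Set (EuclideanSpace ℝ (Fin p))} (hB : MeasurableSet B) :
    ENNReal.ofReal (rawWeight X lam pr (apply X b₀ + e) S)
        * (multivariateGaussian (leastSquares X S (apply X b₀ + e)) (gram X S)⁻¹).map (embed S) B
      = ENNReal.ofReal (Real.exp (‖apply X b₀ + e‖ ^ 2 / 2 - ‖e‖ ^ 2 / 2))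
        * (ENNReal.ofReal (modelWeight lam pr S) * modelMass X b₀ e 0 S B) := by
  set Y := apply X b₀ + e with hY
  set m := leastSquares X S Y with hm
  have hdet := hG.det_pos
  have hw : 0 ≤ modelWeight lam pr S := by unfold modelWeight; positivity
  have hpre := measurable_embed S hB
  rw [Measure.map_apply (measurable_embed S) hB, ← lintegral_indicator_one hpre,
    lintegral_multivariateGaussian_inv hG m (measurable_one.indicator hpre),
    modelMass_eq _ _ _ _ _ hB, ← lintegral_indicator hpre, ← mul_assoc, ← mul_assoc,
    ← ENNReal.ofReal_mul (by unfold rawWeight; positivity),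
    ← ENNReal.ofReal_mul (by positivity)]
  have hquad : Measurable fun b : EuclideanSpace ℝ S =>
      (b - m).ofLp ⬝ᵥ gram X S *ᵥ (b - m).ofLp := by
    simp only [dotProduct, Matrix.mulVec]
    fun_prop
  rw [← lintegral_const_mul, ← lintegral_const_mul]
  rotate_left
  · exact Measurable.indicator (by fun_prop) hpre
  · exact (measurable_one.indicator hpre).mul (by fun_prop)
  refine lintegral_congr fun b => ?_
  by_cases hb : b ∈ embed S ⁻¹' B
  swap
  · simp [hb]
  rw [Set.indicator_of_mem hb, Set.indicator_of_mem hb, Pi.one_apply, one_mul,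
    ← ENNReal.ofReal_mul (by unfold rawWeight; positivity),
    ← ENNReal.ofReal_mul (by positivity)]
  congr 1
  have h1 := exp_neg_norm_sub_sq X b₀ e (embed S b) 0
  have h2 : (b - m).ofLp ⬝ᵥ gram X S *ᵥ (b - m).ofLp = ‖apply (cols X S) (b - m)‖ ^ 2 := by
    rw [norm_apply_sq, gram]
  have h3 := norm_sub_apply_cols_sq X S Y b
  rw [← hm] at h3
  simp only [zero_mul, neg_zero, Real.exp_zero, mul_one, sub_zero] at h1
  rw [← hY, apply_embed, h3] at h1
  have h4 : relDensity X b₀ e 0 (embed S b) = Real.exp (‖e‖ ^ 2 / 2)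
      * Real.exp (-(‖Y‖ ^ 2 - ‖apply (cols X S) m‖ ^ 2
        + ‖apply (cols X S) (b - m)‖ ^ 2) / 2) := by
    rw [h1, ← mul_assoc, ← Real.exp_add]
    ring_nf
    simp
  rw [h4, h2, rawWeight, ← hm, modelWeight, Fintype.card_coe]
  have h5 : (2 * Real.pi) ^ ((S.card : ℝ) / 2) * (2 * Real.pi) ^ (-((S.card : ℝ) / 2)) = 1 := by
    rw [← Real.rpow_add (by positivity), add_neg_cancel, Real.rpow_zero]
  have h6 : (gram X S).det ^ (-(1 / 2) : ℝ) * (gram X S).det ^ (1 / 2 : ℝ) = 1 := by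
    rw [← Real.rpow_add hdet, neg_add_cancel, Real.rpow_zero]
  have h7 : Real.exp (1 / 2 * ‖apply (cols X S) m‖ ^ 2)
      * Real.exp (-‖apply (cols X S) (b - m)‖ ^ 2 / 2)
      = Real.exp (‖Y‖ ^ 2 / 2 - ‖e‖ ^ 2 / 2) * (Real.exp (‖e‖ ^ 2 / 2)
      * Real.exp (-(‖Y‖ ^ 2 - ‖apply (cols X S) m‖ ^ 2
        + ‖apply (cols X S) (b - m)‖ ^ 2) / 2)) := by
    rw [← Real.exp_add, ← Real.exp_add, ← Real.exp_add]
    congr 1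
    ring
  calc _ = pr S.card / (p.choose S.card : ℝ) * (lam / 2) ^ S.card
        * ((2 * Real.pi) ^ ((S.card : ℝ) / 2) * (2 * Real.pi) ^ (-((S.card : ℝ) / 2)))
        * ((gram X S).det ^ (-(1 / 2) : ℝ) * (gram X S).det ^ (1 / 2 : ℝ))
        * (Real.exp (1 / 2 * ‖apply (cols X S) m‖ ^ 2)
          * Real.exp (-‖apply (cols X S) (b - m)‖ ^ 2 / 2)) := by ring
    _ = _ := by rw [h5, h6, h7]; ring

variable {κ M : ℝ}

/-- The limit as a normalized mixture over the models in the neighbourhood. -/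
lemma limitPosterior_apply (hlam : 0 < lam) (hpr : ∀ s ≤ p, 0 < pr s)
    (hG : ∀ S ∈ nbhdModels X κ M b₀, (gram X S).PosDef)
    (hne : (nbhdModels X κ M b₀).Nonempty)
    {B : Set (EuclideanSpace ℝ (Fin p))} (hB : MeasurableSet B) :
    limitPosterior X lam pr κ M b₀ (apply X b₀ + e) B
      = (∑ S ∈ nbhdModels X κ M b₀,
            ENNReal.ofReal (modelWeight lam pr S) * modelMass X b₀ e 0 S Set.univ)⁻¹
        * ∑ S ∈ nbhdModels X κ M b₀,
            ENNReal.ofReal (modelWeight lam pr S) * modelMass X b₀ e 0 S B := by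
  have hprS : ∀ S : Finset (Fin p), 0 < pr S.card := fun S =>
    hpr _ (by simpa using S.card_le_univ)
  have hraw : ∀ S ∈ nbhdModels X κ M b₀, 0 < rawWeight X lam pr (apply X b₀ + e) S := by
    intro S hS
    have h1 := (hG S hS).det_pos
    have h2 := hprS S
    have h3 : (0 : ℝ) < p.choose S.card := by
      exact_mod_cast Nat.choose_pos (by simpa using S.card_le_univ)
    unfold rawWeight
    positivity
  have hsum := Finset.sum_pos hraw hne
  have hA : ∀ S ∈ nbhdModels X κ M b₀, ENNReal.ofReal (rawWeight X lam pr (apply X b₀ + e) S)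
      = ENNReal.ofReal (Real.exp (‖apply X b₀ + e‖ ^ 2 / 2 - ‖e‖ ^ 2 / 2))
        * (ENNReal.ofReal (modelWeight lam pr S) * modelMass X b₀ e 0 S Set.univ) := by
    intro S hS
    rw [← ofReal_rawWeight_mul X b₀ e hlam (hprS S).le (hG S hS) .univ,
      Measure.map_apply (measurable_embed S) .univ, Set.preimage_univ, measure_univ, mul_one]
  rw [limitPosterior, Measure.finsetSum_apply]
  simp_rw [Measure.smul_apply, smul_eq_mul, ENNReal.ofReal_div_of_pos hsum, div_eq_mul_inv,
    mul_right_comm _ _ (((multivariateGaussian _ _).map _) B)]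
  rw [← Finset.sum_mul, Finset.sum_congr rfl fun S hS =>
      ofReal_rawWeight_mul X b₀ e hlam (hprS S).le (hG S hS) hB,
    ENNReal.ofReal_sum_of_nonneg fun S hS => (hraw S hS).le, Finset.sum_congr rfl hA,
    ← Finset.mul_sum, ← Finset.mul_sum, mul_comm,
    inv_mul_mul_cancel_left (ofReal_exp_ne_zero _) ENNReal.ofReal_ne_top]

lemma sum_nbhd_modelMass_ne_top (hlam : 0 < lam) (hpr : ∀ s ≤ p, 0 < pr s)
    (hG : ∀ S ∈ nbhdModels X κ M b₀, (gram X S).PosDef) :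
    ∑ S ∈ nbhdModels X κ M b₀,
      ENNReal.ofReal (modelWeight lam pr S) * modelMass X b₀ e 0 S Set.univ ≠ ∞ := by
  refine ENNReal.sum_ne_top.2 fun S hS htop => ?_
  have h := ofReal_rawWeight_mul X b₀ e hlam (hpr S.card (by simpa using S.card_le_univ)).le
    (hG S hS) .univ
  rw [htop, ENNReal.mul_top (ofReal_exp_ne_zero _), Measure.map_apply (measurable_embed S) .univ,
    Set.preimage_univ, measure_univ, mul_one] at h
  exact ENNReal.ofReal_ne_top h

lemma isProbabilityMeasure_limitPosterior (hlam : 0 < lam) (hpr : ∀ s ≤ p, 0 < pr s)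
    (hG : ∀ S ∈ nbhdModels X κ M b₀, (gram X S).PosDef)
    (hne : (nbhdModels X κ M b₀).Nonempty)
    (h0 : ∑ S ∈ nbhdModels X κ M b₀,
      ENNReal.ofReal (modelWeight lam pr S) * modelMass X b₀ e 0 S Set.univ ≠ 0) :
    IsProbabilityMeasure (limitPosterior X lam pr κ M b₀ (apply X b₀ + e)) :=
  ⟨by rw [limitPosterior_apply X b₀ e hlam hpr hG hne .univ,
    ENNReal.inv_mul_cancel h0 (sum_nbhd_modelMass_ne_top X b₀ e hlam hpr hG)]⟩

end Mixtures

/-! ### The `ℓ¹` norm and the columns of the design -/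

section Columns

variable {n p : ℕ} (X : Matrix (Fin n) (Fin p) ℝ)

lemma l1On_nonneg (S : Finset (Fin p)) (b : EuclideanSpace ℝ (Fin p)) : 0 ≤ l1On S b :=
  Finset.sum_nonneg fun _ _ => abs_nonneg _

lemma l1On_mono {S T : Finset (Fin p)} (h : S ⊆ T) (b : EuclideanSpace ℝ (Fin p)) :
    l1On S b ≤ l1On T b :=
  Finset.sum_le_sum_of_subset_of_nonneg h fun _ _ _ => abs_nonneg _

lemma l1On_add_compl (S : Finset (Fin p)) (b : EuclideanSpace ℝ (Fin p)) :
    l1On S b + l1On Sᶜ b = l1On Finset.univ b := Finset.sum_add_sum_compl S _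

lemma l1On_sub_le (S : Finset (Fin p)) (a b : EuclideanSpace ℝ (Fin p)) :
    l1On S a - l1On S b ≤ l1On S (a - b) := by
  unfold l1On
  rw [← Finset.sum_sub_distrib]
  exact Finset.sum_le_sum fun i _ => abs_sub_abs_le_abs_sub _ _

lemma l1On_sub_comm (S : Finset (Fin p)) (a b : EuclideanSpace ℝ (Fin p)) :
    l1On S (a - b) = l1On S (b - a) :=
  Finset.sum_congr rfl fun _ _ => abs_sub_comm _ _

/-- The columns of the design matrix. -/
def colVec (j : Fin p) : EuclideanSpace ℝ (Fin n) := WithLp.toLp 2 fun i => X i j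

lemma norm_colVec_le (j : Fin p) : ‖colVec X j‖ ≤ colNorm X := by
  have h : ‖colVec X j‖ = Real.sqrt (∑ i, X i j ^ 2) := by
    simp [EuclideanSpace.norm_eq, colVec]
  rw [h]
  exact le_ciSup (f := fun j : Fin p => Real.sqrt (∑ i, X i j ^ 2)) (Set.finite_range _).bddAbove j

lemma apply_eq_sum (b : EuclideanSpace ℝ (Fin p)) : apply X b = ∑ j, b j • colVec X j := by
  ext i
  simp [apply, colVec, Matrix.mulVec, dotProduct, mul_comm]

lemma norm_apply_le (b : EuclideanSpace ℝ (Fin p)) :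
    ‖apply X b‖ ≤ colNorm X * l1On Finset.univ b := by
  rw [apply_eq_sum, l1On, Finset.mul_sum]
  refine (norm_sum_le _ _).trans (Finset.sum_le_sum fun j _ => ?_)
  rw [norm_smul, Real.norm_eq_abs, mul_comm]
  exact mul_le_mul_of_nonneg_right (norm_colVec_le X j) (abs_nonneg _)

/-- The event that the noise has small inner products with all columns. -/
def noiseEvent : Set (EuclideanSpace ℝ (Fin n)) :=
  {e | ∀ j, |inner ℝ e (colVec X j)| ≤ lamBar X}

lemma measurableSet_noiseEvent : MeasurableSet (noiseEvent X) := by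
  have : noiseEvent X = ⋂ j, {e | |inner ℝ e (colVec X j)| ≤ lamBar X} := by
    ext; simp [noiseEvent]
  rw [this]
  exact MeasurableSet.iInter fun j => measurableSet_le (by fun_prop) (by fun_prop)

variable {X}

lemma inner_apply_le {e : EuclideanSpace ℝ (Fin n)} (he : e ∈ noiseEvent X)
    (b : EuclideanSpace ℝ (Fin p)) :
    inner ℝ e (apply X b) ≤ lamBar X * l1On Finset.univ b := by
  rw [apply_eq_sum, inner_sum, l1On, Finset.mul_sum]
  refine Finset.sum_le_sum fun j _ => ?_
  rw [inner_smul_right, mul_comm]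
  calc _ ≤ |inner ℝ e (colVec X j) * b j| := le_abs_self _
    _ = |inner ℝ e (colVec X j)| * |b j| := abs_mul _ _
    _ ≤ _ := mul_le_mul_of_nonneg_right (he j) (abs_nonneg _)

/-- Chernoff's bound, with the exponent `t = L / x²` that is optimal for the largest admissible
variance `x²`. -/
lemma stdGaussian_inner_gt_le {v : EuclideanSpace ℝ (Fin n)} {x L : ℝ} (hx : 0 < x) (hL : 0 ≤ L)
    (hv : ‖v‖ ≤ x) :
    stdGaussian (EuclideanSpace ℝ (Fin n)) {e | L < inner ℝ v e}
      ≤ ENNReal.ofReal (Real.exp (-(L ^ 2 / (2 * x ^ 2)))) := by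
  set t := L / x ^ 2 with ht
  have ht0 : 0 ≤ t := by positivity
  have h1 : ∀ e ∈ {e : EuclideanSpace ℝ (Fin n) | L < inner ℝ v e},
      (1 : ℝ≥0∞) ≤ ENNReal.ofReal (Real.exp (-(t * L)))
        * ENNReal.ofReal (Real.exp (inner ℝ (t • v) e)) := by
    intro e he
    rw [← ENNReal.ofReal_mul (Real.exp_pos _).le, ← Real.exp_add, ENNReal.one_le_ofReal,
      Real.one_le_exp_iff, real_inner_smul_left]
    have : t * L ≤ t * inner ℝ v e := mul_le_mul_of_nonneg_left (le_of_lt he) ht0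
    linarith
  have hms : MeasurableSet {e : EuclideanSpace ℝ (Fin n) | L < inner ℝ v e} :=
    measurableSet_lt (by fun_prop) (by fun_prop)
  calc _ = ∫⁻ _ in {e : EuclideanSpace ℝ (Fin n) | L < inner ℝ v e}, 1
        ∂(stdGaussian (EuclideanSpace ℝ (Fin n))) := by simp
    _ ≤ ∫⁻ e in {e : EuclideanSpace ℝ (Fin n) | L < inner ℝ v e},
        ENNReal.ofReal (Real.exp (-(t * L))) * ENNReal.ofReal (Real.exp (inner ℝ (t • v) e))
        ∂(stdGaussian (EuclideanSpace ℝ (Fin n))) := setLIntegral_mono' hms h1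
    _ ≤ ∫⁻ e, ENNReal.ofReal (Real.exp (-(t * L)))
        * ENNReal.ofReal (Real.exp (inner ℝ (t • v) e))
        ∂(stdGaussian (EuclideanSpace ℝ (Fin n))) := setLIntegral_le_lintegral _ _
    _ = ENNReal.ofReal (Real.exp (-(t * L) + ‖t • v‖ ^ 2 / 2)) := by
        rw [lintegral_const_mul _ (by fun_prop), lintegral_exp_inner_stdGaussian,
          ← ENNReal.ofReal_mul (Real.exp_pos _).le, ← Real.exp_add]
    _ ≤ _ := by
        refine ENNReal.ofReal_le_ofReal (Real.exp_le_exp.2 ?_)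
        rw [norm_smul, Real.norm_eq_abs, abs_of_nonneg ht0]
        have h2 : (t * ‖v‖) ^ 2 ≤ (t * x) ^ 2 := by gcongr
        have h3 : -(t * L) + (t * x) ^ 2 / 2 = -(L ^ 2 / (2 * x ^ 2)) := by
          rw [ht]; field_simp; ring
        linarith

/-- Union bound over `2p` half-spaces: the level `lamBar X` is such that each has probability at
most `p^(-2)`. -/
lemma stdGaussian_noiseEvent_compl_le (hx : 0 < colNorm X) (hp : 1 ≤ p) :
    stdGaussian (EuclideanSpace ℝ (Fin n)) (noiseEvent X)ᶜ ≤ ENNReal.ofReal (2 / p) := by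
  have hp0 : (0 : ℝ) < p := by exact_mod_cast hp
  have hlog : 0 ≤ Real.log p := Real.log_nonneg (by exact_mod_cast hp)
  have hL : 0 ≤ lamBar X := by unfold lamBar; positivity
  have hexp : Real.exp (-(lamBar X ^ 2 / (2 * colNorm X ^ 2))) = 1 / (p : ℝ) ^ 2 := by
    have : -(lamBar X ^ 2 / (2 * colNorm X ^ 2)) = -(Real.log p + Real.log p) := by
      rw [lamBar, mul_pow, mul_pow, Real.sq_sqrt hlog]; field_simp; ring
    rw [this, Real.exp_neg, Real.exp_add, Real.exp_log hp0, sq, one_div]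
  have hsub : (noiseEvent X)ᶜ ⊆ ⋃ j, ({e | lamBar X < inner ℝ (colVec X j) e}
      ∪ {e | lamBar X < inner ℝ (-colVec X j) e}) := by
    intro e he
    simp only [noiseEvent, Set.mem_compl_iff, Set.mem_ofPred_eq, not_forall, not_le] at he
    obtain ⟨j, hj⟩ := he
    refine Set.mem_iUnion.2 ⟨j, ?_⟩
    rw [real_inner_comm] at hj
    rcases lt_abs.1 hj with h | h
    · exact Or.inl h
    · exact Or.inr (by simpa [inner_neg_left] using h)
  calc _ ≤ _ := measure_mono hsub
    _ ≤ ∑ j : Fin p, (ENNReal.ofReal (1 / (p : ℝ) ^ 2) + ENNReal.ofReal (1 / (p : ℝ) ^ 2)) := by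
        refine (measure_iUnion_fintype_le _ _).trans (Finset.sum_le_sum fun j _ => ?_)
        refine (measure_union_le _ _).trans (add_le_add ?_ ?_)
        · rw [← hexp]
          exact stdGaussian_inner_gt_le hx hL (norm_colVec_le X j)
        · rw [← hexp]
          exact stdGaussian_inner_gt_le hx hL (by rw [norm_neg]; exact norm_colVec_le X j)
    _ = _ := by
        rw [← ENNReal.ofReal_add (by positivity) (by positivity), Finset.sum_const,
          Finset.card_univ, Fintype.card_fin, nsmul_eq_mul, ← ENNReal.ofReal_natCast,
          ← ENNReal.ofReal_mul (by positivity)]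
        congr 1
        field_simp
        ring

end Columns

/-! ### Compatibility -/

section Compatibility

variable {n p : ℕ} {X : Matrix (Fin n) (Fin p) ℝ} {c : ℝ}

/-- Multiplied out, the inequality also covers `β_S = 0`, which the infimum excludes. -/
lemma le_norm_apply_of_compat {S : Finset (Fin p)} (hx : 0 < colNorm X)
    (h : ENNReal.ofReal c ≤ compat X S) {b : EuclideanSpace ℝ (Fin p)}
    (hcone : l1On Sᶜ b ≤ 7 * l1On S b) :
    c * (colNorm X * l1On S b) ≤ ‖apply X b‖ * Real.sqrt S.card := by
  rcases (l1On_nonneg S b).eq_or_lt with h0 | h0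
  · rw [← h0]; simp; positivity
  have hex : ∃ i ∈ S, b i ≠ 0 := by
    by_contra! hcon
    exact h0.ne' (Finset.sum_eq_zero fun i hi => by rw [hcon i hi, abs_zero])
  have h1 := h.trans (iInf₂_le b ⟨hcone, hex⟩)
  rw [ENNReal.ofReal_le_ofReal_iff (by positivity), le_div_iff₀ (by positivity)] at h1
  exact h1

lemma le_norm_apply_of_unifCompat {s : ℝ} (hx : 0 < colNorm X)
    (h : ENNReal.ofReal c ≤ unifCompat X (ENNReal.ofReal s)) {b : EuclideanSpace ℝ (Fin p)}
    (hb : ((supp b).card : ℝ) ≤ s) :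
    c * (colNorm X * l1On Finset.univ b) ≤ ‖apply X b‖ * Real.sqrt s := by
  have hl1 : l1On Finset.univ b = l1On (supp b) b := by
    rw [← l1On_add_compl (supp b)]
    have : l1On (supp b)ᶜ b = 0 := Finset.sum_eq_zero fun i hi => by
      have : b i = 0 := by simpa [supp] using hi
      rw [this, abs_zero]
    rw [this, add_zero]
  rcases (l1On_nonneg Finset.univ b).eq_or_lt with h0 | h0
  · rw [← h0]; simp; positivity
  have hcard : (supp b).card ≠ 0 := by
    intro hcard
    rw [Finset.card_eq_zero] at hcard
    rw [hl1, hcard] at h0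
    simp [l1On] at h0
  have hle : ((supp b).card : ℝ≥0∞) ≤ ENNReal.ofReal s := by
    rw [← ENNReal.ofReal_natCast]
    exact ENNReal.ofReal_le_ofReal hb
  have h1 := h.trans (iInf₂_le b ⟨hcard, hle⟩)
  rw [ENNReal.ofReal_le_ofReal_iff (by positivity), le_div_iff₀ (by positivity)] at h1
  exact h1.trans (mul_le_mul_of_nonneg_left (Real.sqrt_le_sqrt hb) (norm_nonneg _))

/-- A null vector of `X_S` would extend by zero to a sparse nonzero `β` with `Xβ = 0`, contradicting
uniform compatibility. -/
lemma posDef_gram_of_unifCompat {s : ℝ} (hc : 0 < c) (hx : 0 < colNorm X)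
    (h : ENNReal.ofReal c ≤ unifCompat X (ENNReal.ofReal s)) {S : Finset (Fin p)}
    (hS : (S.card : ℝ) ≤ s) : (gram X S).PosDef := by
  refine Matrix.PosDef.of_dotProduct_mulVec_pos ?_ fun v hv => ?_
  · rw [gram, ← Matrix.conjTranspose_eq_transpose_of_trivial]
    exact Matrix.isHermitian_conjTranspose_mul_self _
  · set b : EuclideanSpace ℝ S := WithLp.toLp 2 v with hb
    have h1 : star v ⬝ᵥ gram X S *ᵥ v = ‖apply (cols X S) b‖ ^ 2 := by
      rw [norm_apply_sq, gram, star_trivial]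
    rw [h1, ← apply_embed]
    have h2 := le_norm_apply_of_unifCompat hx h (b := embed S b)
      (le_trans (by exact_mod_cast Finset.card_le_card (supp_embed_subset S b)) hS)
    have h3 : 0 < l1On Finset.univ (embed S b) := by
      rw [l1On_embed]
      obtain ⟨i, hi⟩ := Function.ne_iff.1 hv
      exact Finset.sum_pos' (fun _ _ => abs_nonneg _) ⟨i, Finset.mem_univ _, abs_pos.2 hi⟩
    have h4 : 0 < ‖apply X (embed S b)‖ * Real.sqrt s := lt_of_lt_of_le (by positivity) h2
    have h5 : ‖apply X (embed S b)‖ ≠ 0 := by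
      intro h0; rw [h0, zero_mul] at h4; exact lt_irrefl _ h4
    positivity

end Compatibility

/-! ### Lower bound on the normalizing constants -/

section LowerBound

variable {n p : ℕ} {X : Matrix (Fin n) (Fin p) ℝ} (b₀ : EuclideanSpace ℝ (Fin p))
  (e : EuclideanSpace ℝ (Fin n)) {lam : ℝ} {pr : ℕ → ℝ}

/-- On a cube of radius `r` around `b₀` the noise term is odd, so its exponential averages to at
least one whatever `e` is. The quadratic term costs at most `1/2` by `h1` and the penalty at most
`δ` by `h2`. -/
lemma le_modelMass_supp {t r δ : ℝ} (ht : 0 ≤ t) (hr : 0 ≤ r)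
    (h1 : colNorm X * ((supp b₀).card * r) ≤ 1) (h2 : t * ((supp b₀).card * r) ≤ δ) :
    ENNReal.ofReal (Real.exp (-1 / 2 - δ) * (2 * r) ^ (supp b₀).card)
      ≤ modelMass X b₀ e t (supp b₀) Set.univ := by
  set S := supp b₀ with hS
  set Q : Set (EuclideanSpace ℝ S) := {b | ∀ i, |b i| ≤ r} with hQ
  have hQm : MeasurableSet Q := measurableSet_cube r
  have hL := volume_le_setLIntegral_exp_odd hQm (L := fun b => inner ℝ e (apply X (embed S b)))
    (fun b hb i => by simpa using hb i)
    (by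
      have : Measurable fun b : EuclideanSpace ℝ S => apply X (embed S b) :=
        (measurable_apply X).comp (measurable_embed S)
      fun_prop)
    (fun b => by
      have : embed S (-b) = -embed S b := map_neg (embedLin S) b
      rw [this, apply_neg, inner_neg_right])
  rw [hQ, volume_cube hr, ← hQ, Fintype.card_coe] at hL
  rw [modelMass_eq _ _ _ _ _ .univ, Set.preimage_univ, setLIntegral_univ,
    ← lintegral_add_left_eq_self _ (coords S b₀), ENNReal.ofReal_mul (Real.exp_pos _).le]
  refine (mul_le_mul_right hL _).trans ?_
  rw [← lintegral_const_mul' _ _ ENNReal.ofReal_ne_top]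
  refine le_trans ?_ (setLIntegral_le_lintegral Q _)
  refine setLIntegral_mono' hQm fun b hb => ?_
  rw [← ENNReal.ofReal_mul (Real.exp_pos _).le, ← Real.exp_add]
  refine ENNReal.ofReal_le_ofReal (Real.exp_le_exp.2 ?_)
  have hemb : embed S (coords S b₀ + b) = b₀ + embed S b := by
    rw [embed_add]
    exact congrArg (· + embed S b) (embed_coords_supp b₀)
  rw [hemb, add_sub_cancel_left]
  have hl1 : l1On Finset.univ (embed S b) ≤ S.card * r := by
    rw [l1On_embed]
    refine (Finset.sum_le_sum fun i _ => hb i).trans ?_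
    simp
  have hx0 : 0 ≤ colNorm X := Real.iSup_nonneg fun j => Real.sqrt_nonneg _
  have h3 : ‖apply X (embed S b)‖ ≤ 1 :=
    (norm_apply_le X _).trans ((mul_le_mul_of_nonneg_left hl1 hx0).trans h1)
  have h4 : ‖apply X (embed S b)‖ ^ 2 ≤ 1 := pow_le_one₀ (norm_nonneg _) h3
  have h5 := l1On_sub_le Finset.univ (b₀ + embed S b) b₀
  rw [add_sub_cancel_left] at h5
  have h6 : t * (l1On Finset.univ (b₀ + embed S b) - l1On Finset.univ b₀) ≤ δ :=
    (mul_le_mul_of_nonneg_left (h5.trans hl1) ht).trans h2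
  linarith

/-- A lower bound for the unnormalized posterior mass of the true model. -/
def massLowerBound (p : ℕ) (pr : ℕ → ℝ) (δ : ℝ) (s : ℕ) : ℝ :=
  pr s * (Real.exp (-1 / 2 - δ) * ((Real.exp 1 * (p : ℝ) ^ 2) ^ s)⁻¹)

/-- The radius `r = 1 / (s ‖X‖)` is the largest that `h1` allows. With `λ ≥ ‖X‖ / p` one has `λ r ≥
1 / (s p)`, and `p.choose s ≤ p^s / s!` and `s^s / s! ≤ e^s` leave `(e p²)^(-s)`. The bound is
needed for the rates `0` and `lam`. -/
lemma massLowerBound_le {t δ : ℝ} (ht : 0 ≤ t) (htl : t ≤ lam) (hx : 0 < colNorm X)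
    (hp : 1 ≤ p) (hlam : colNorm X / p ≤ lam) (hδ0 : 0 ≤ δ)
    (hδ : (supp b₀).card ≠ 0 → lam / colNorm X ≤ δ) (hpr : 0 ≤ pr (supp b₀).card) :
    ENNReal.ofReal (massLowerBound p pr δ (supp b₀).card)
      ≤ ENNReal.ofReal (modelWeight lam pr (supp b₀))
        * modelMass X b₀ e t (supp b₀) Set.univ := by
  set s := (supp b₀).card with hs
  have hp0 : (0 : ℝ) < p := by exact_mod_cast hp
  have hsp : s ≤ p := by simpa using (supp b₀).card_le_univ
  set r : ℝ := 1 / (s * colNorm X) with hr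
  have hr0 : 0 ≤ r := by positivity
  have h1 : colNorm X * (s * r) ≤ 1 := by
    rcases Nat.eq_zero_or_pos s with h0 | h0
    · simp [h0]
    · have : (0 : ℝ) < s := by exact_mod_cast h0
      rw [hr]; apply le_of_eq; field_simp
  have h2 : t * (s * r) ≤ δ := by
    rcases Nat.eq_zero_or_pos s with h0 | h0
    · simpa [h0] using hδ0
    · have h3 : (0 : ℝ) < s := by exact_mod_cast h0
      have : s * r = 1 / colNorm X := by rw [hr]; field_simp
      rw [this, mul_one_div]
      exact (div_le_div_of_nonneg_right htl hx.le).trans (hδ h0.ne')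
  have hlam0 : 0 < lam := lt_of_lt_of_le (by positivity) hlam
  refine le_trans ?_ (mul_le_mul_right (le_modelMass_supp b₀ e ht hr0 h1 h2) _)
  rw [← ENNReal.ofReal_mul (by unfold modelWeight; positivity)]
  refine ENNReal.ofReal_le_ofReal ?_
  rw [massLowerBound, modelWeight, ← hs]
  have hch : (0 : ℝ) < p.choose s := by exact_mod_cast Nat.choose_pos hsp
  have hkey : ((Real.exp 1 * (p : ℝ) ^ 2) ^ s)⁻¹
      ≤ (lam / 2) ^ s * (2 * r) ^ s / (p.choose s : ℝ) := by
    rw [← mul_pow, show lam / 2 * (2 * r) = lam * r by ring, le_div_iff₀ hch,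
      inv_mul_le_iff₀ (by positivity)]
    have hc1 : (p.choose s : ℝ) ≤ (p : ℝ) ^ s / s.factorial := Nat.choose_le_pow_div s p
    have hc2 : (s : ℝ) ^ s / s.factorial ≤ Real.exp s :=
      Real.pow_div_factorial_le_exp _ (by positivity) s
    -- The quotient `s / s` is `1` in general and `0` for `s = 0`, when `r = 0` too.
    have hlr : s * p * (lam * r) ≥ s / s := by
      rcases Nat.eq_zero_or_pos s with h0 | h0
      · simp [h0]
      · have h3 : (0 : ℝ) < s := by exact_mod_cast h0
        rw [div_le_iff₀ hp0] at hlam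
        rw [hr, ge_iff_le, div_self h3.ne']
        rw [show s * p * (lam * (1 / (s * colNorm X))) = lam * p / colNorm X by field_simp]
        rwa [one_le_div hx]
    have hlr2 : 1 ≤ (s * p * (lam * r)) ^ s := by
      rcases Nat.eq_zero_or_pos s with h0 | h0
      · simp [h0]
      · have h3 : (0 : ℝ) < s := by exact_mod_cast h0
        rw [div_self h3.ne'] at hlr
        exact one_le_pow₀ hlr
    calc (p.choose s : ℝ) ≤ (p : ℝ) ^ s / s.factorial * 1 := by rw [mul_one]; exact hc1
      _ ≤ (p : ℝ) ^ s / s.factorial * (s * p * (lam * r)) ^ s := by gcongr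
      _ = (s : ℝ) ^ s / s.factorial * ((p : ℝ) ^ 2) ^ s * (lam * r) ^ s := by
          rw [mul_pow, mul_pow, ← pow_mul, mul_comm 2 s, pow_mul]; ring
      _ ≤ Real.exp s * ((p : ℝ) ^ 2) ^ s * (lam * r) ^ s := by gcongr
      _ = _ := by rw [mul_pow (Real.exp 1), ← Real.exp_nat_mul, mul_one]
  calc _ ≤ pr s * (Real.exp (-1 / 2 - δ)
        * ((lam / 2) ^ s * (2 * r) ^ s / (p.choose s : ℝ))) := by gcongr
    _ = _ := by ring

end LowerBound

/-! ### Laplace integrals on a model and averages over models. -/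

section

variable {n p : ℕ} {X : Matrix (Fin n) (Fin p) ℝ} {b₀ : EuclideanSpace ℝ (Fin p)}
  {e : EuclideanSpace ℝ (Fin n)} {lam : ℝ} {pr : ℕ → ℝ}

/-- Coordinates of `b₀` outside `S` only increase the distance; without them this is a translated
Laplace integral. -/
lemma lintegral_exp_neg_l1_embed_sub_le {a K : ℝ} (ha : 0 < a) (hK : 0 ≤ K) (S : Finset (Fin p)) :
    ∫⁻ b : EuclideanSpace ℝ S,
        ENNReal.ofReal (K * Real.exp (-(a * l1On Finset.univ (embed S b - b₀))))
      ≤ ENNReal.ofReal (K * (2 / a) ^ S.card) := by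
  rw [ENNReal.ofReal_mul hK, ← Fintype.card_coe, ← lintegral_exp_neg_l1 ha,
    ← lintegral_sub_right_eq_self (fun b : EuclideanSpace ℝ S =>
      ENNReal.ofReal (Real.exp (-(a * ∑ i, |b i|)))) (coords S b₀),
    ← lintegral_const_mul' _ _ ENNReal.ofReal_ne_top]
  refine lintegral_mono fun b => ?_
  rw [← ENNReal.ofReal_mul hK]
  refine ENNReal.ofReal_le_ofReal (mul_le_mul_of_nonneg_left (Real.exp_le_exp.2 ?_) hK)
  refine neg_le_neg (mul_le_mul_of_nonneg_left ?_ ha.le)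
  have hmono := l1On_mono (Finset.subset_univ S) (embed S b - b₀)
  rw [l1On, ← Finset.sum_coe_sort] at hmono
  refine le_trans (le_of_eq (Finset.sum_congr rfl fun i _ => ?_)) hmono
  rw [PiLp.sub_apply, PiLp.sub_apply, embed_apply_of_mem S b i.2, coords_apply]

/-- Averaging a function of the dimension over all models. -/
lemma sum_div_choose_eq (f : ℕ → ℝ) :
    ∑ S : Finset (Fin p), f S.card / (p.choose S.card : ℝ) = ∑ s ∈ Finset.range (p + 1), f s := by
  have h := Finset.sum_powerset_apply_card (fun s => f s / (p.choose s : ℝ))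
    (x := (Finset.univ : Finset (Fin p)))
  rw [Finset.powerset_univ, Finset.card_univ, Fintype.card_fin] at h
  rw [h]
  refine Finset.sum_congr rfl fun s hs => ?_
  have hc : (0 : ℝ) < p.choose s := by
    exact_mod_cast Nat.choose_pos (Nat.lt_succ_iff.1 (Finset.mem_range.1 hs))
  rw [nsmul_eq_mul]
  field_simp

/-! ### Contraction of the mixtures restricted to small models -/

section Contraction

/-- The vectors at large `ℓ¹` distance from `b₀`. -/
def farSet (b₀ : EuclideanSpace ℝ (Fin p)) (R : ℝ) : Set (EuclideanSpace ℝ (Fin p)) :=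
  {b | R < l1On Finset.univ (b - b₀)}

lemma measurableSet_farSet (R : ℝ) : MeasurableSet (farSet b₀ R) :=
  measurableSet_lt measurable_const ((measurable_l1On _).comp (by fun_prop))

lemma card_supp_sub_le (a b : EuclideanSpace ℝ (Fin p)) :
    (supp (a - b)).card ≤ (supp a).card + (supp b).card := by
  refine (Finset.card_le_card ?_).trans (Finset.card_union_le _ _)
  intro i hi
  by_contra h
  simp only [supp, Finset.mem_union, Finset.mem_filter, Finset.mem_univ, true_and, not_or,
    not_not] at h hi
  simp [h.1, h.2] at hi

variable {c κ M N t : ℝ}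

/-- Write `x = ‖X‖`, `ℓ = √(log p)` and `L` for the distance. Compatibility makes the quadratic term
at least a multiple of `L²`; trading one factor `L` for its lower bound `M s ℓ / x` gives at least
`(N + 7) x ℓ L`. The noise costs `2 x ℓ L` and the penalty at most `4 x ℓ L`; one unit is kept for
integrability, and the other `N` give the first factor because `x ℓ L ≥ s log p`. If `b₀ = 0`, no
sparse vector is far, whence the second conclusion. -/
lemma relDensity_le_of_mem_farSet (hc : 0 < c) (hκ : 0 ≤ κ) (hM : 1 ≤ M) (hN : 0 ≤ N)
    (hNM : N + 7 ≤ c ^ 2 * M / (2 * (1 + κ))) (hx : 0 < colNorm X)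
    (hp : 1 ≤ p) (he : e ∈ noiseEvent X) (ht : 0 ≤ t) (htl : t ≤ 2 * lamBar X)
    (hcompat : ENNReal.ofReal c ≤ unifCompat X (ENNReal.ofReal ((1 + κ) * (supp b₀).card)))
    {b : EuclideanSpace ℝ (Fin p)} (hb : ((supp b).card : ℝ) ≤ κ * (supp b₀).card)
    (hfar : b ∈ farSet b₀ (M * (supp b₀).card * Real.sqrt (Real.log p) / colNorm X)) :
    relDensity X b₀ e t b ≤ Real.exp (-(N * (supp b₀).card * Real.log p))
        * Real.exp (-(colNorm X * Real.sqrt (Real.log p) * l1On Finset.univ (b - b₀)))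
      ∧ (supp b₀).card ≠ 0 := by
  have hlog : 0 ≤ Real.log p := Real.log_nonneg (by exact_mod_cast hp)
  have hell2 : Real.sqrt (Real.log p) ^ 2 = Real.log p := Real.sq_sqrt hlog
  have hsub : ((supp (b - b₀)).card : ℝ) ≤ (1 + κ) * (supp b₀).card := by
    have h : ((supp (b - b₀)).card : ℝ) ≤ (supp b).card + (supp b₀).card := by
      exact_mod_cast card_supp_sub_le b b₀
    linarith
  have hQ := le_norm_apply_of_unifCompat hx hcompat hsub
  have hin := inner_apply_le he (b - b₀)
  have hl1 := l1On_sub_le Finset.univ b₀ b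
  rw [l1On_sub_comm] at hl1
  simp only [farSet, Set.mem_ofPred_eq] at hfar
  rw [relDensity]
  rw [lamBar] at hin htl
  set s : ℝ := ((supp b₀).card : ℝ) with hs
  set x := colNorm X
  set ell := Real.sqrt (Real.log p)
  set L := l1On Finset.univ (b - b₀)
  set Q := ‖apply X (b - b₀)‖
  have hell : 0 ≤ ell := Real.sqrt_nonneg _
  have hs0 : 0 ≤ s := by positivity
  have hL : 0 < L := lt_of_le_of_lt (by positivity) hfar
  have hsq : (c * (x * L)) ^ 2 ≤ Q ^ 2 * ((1 + κ) * s) := by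
    have := pow_le_pow_left₀ (by positivity) hQ 2
    rwa [mul_pow Q, Real.sq_sqrt (by positivity)] at this
  have hspos : 0 < s := by
    rcases hs0.eq_or_lt with h0 | h0
    · rw [← h0, mul_zero, mul_zero] at hsq
      have : 0 < (c * (x * L)) ^ 2 := by positivity
      linarith
    · exact h0
  refine ⟨?_, by intro h; rw [hs, h] at hspos; simp at hspos⟩
  have hfar' : M * s * ell ≤ L * x := ((div_lt_iff₀ hx).1 hfar).le
  have hQ2 : c ^ 2 * M / (1 + κ) * (x * ell * L) ≤ Q ^ 2 := by
    have h1 : c ^ 2 * (x * L) * (M * s * ell) ≤ Q ^ 2 * ((1 + κ) * s) :=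
      calc _ ≤ c ^ 2 * (x * L) * (L * x) := by gcongr
        _ = (c * (x * L)) ^ 2 := by ring
        _ ≤ _ := hsq
    have h2 : c ^ 2 * M * (x * ell * L) * s ≤ (Q ^ 2 * (1 + κ)) * s := by
      calc _ = c ^ 2 * (x * L) * (M * s * ell) := by ring
        _ ≤ _ := h1
        _ = _ := by ring
    have h3 := le_of_mul_le_mul_right h2 hspos
    rw [div_mul_eq_mul_div, div_le_iff₀ (by positivity)]
    exact h3
  have hxl : 0 ≤ x * ell * L := by positivity
  have hQ3 : (N + 7) * (x * ell * L) ≤ Q ^ 2 / 2 := by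
    have h1 := mul_le_mul_of_nonneg_right hNM hxl
    have h2 : c ^ 2 * M / (2 * (1 + κ)) * (x * ell * L)
        = c ^ 2 * M / (1 + κ) * (x * ell * L) / 2 := by field_simp
    linarith
  have hbig : s * ell ^ 2 ≤ x * ell * L := by
    have h1 : s * ell ≤ L * x := by
      have : s * ell ≤ M * s * ell := by
        have : 0 ≤ s * ell := by positivity
        nlinarith
      linarith
    calc s * ell ^ 2 = (s * ell) * ell := by ring
      _ ≤ (L * x) * ell := by gcongr
      _ = _ := by ring
  rw [← Real.exp_add]
  refine Real.exp_le_exp.2 ?_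
  have h1 : t * (l1On Finset.univ b₀ - l1On Finset.univ b) ≤ 2 * (2 * x * ell) * L :=
    (mul_le_mul_of_nonneg_left hl1 ht).trans (mul_le_mul_of_nonneg_right htl hL.le)
  have h2 := mul_le_mul_of_nonneg_left hbig hN
  have h3 : 2 * x * ell * L = 2 * (x * ell * L) := by ring
  have h4 : 2 * (2 * x * ell) * L = 4 * (x * ell * L) := by ring
  have h5 : N * s * Real.log p = N * (s * ell ^ 2) := by rw [hell2]; ring
  rw [h4] at h1
  rw [h3] at hin
  rw [h5]
  linarith

/-- Integrating the pointwise bound, each coordinate contributes `(λ / 2) * (2 / (‖X‖ √(log p))) ≤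
4`, by `λ ≤ 2 λ̄`; the weights without `(λ / 2)^|S|` sum to one. -/
lemma sum_modelMass_farSet_le (hc : 0 < c) (hκ : 0 ≤ κ) (hM : 1 ≤ M) (hN : 0 ≤ N)
    (hNM : N + 7 ≤ c ^ 2 * M / (2 * (1 + κ))) (hx : 0 < colNorm X)
    (hp : 2 ≤ p) (he : e ∈ noiseEvent X) (ht : 0 ≤ t) (htl : t ≤ 2 * lamBar X)
    (hlam : 0 ≤ lam) (hlam2 : lam ≤ 2 * lamBar X) (hprior : IsDimPrior p pr)
    (hcompat : ENNReal.ofReal c ≤ unifCompat X (ENNReal.ofReal ((1 + κ) * (supp b₀).card))) :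
    ∑ S : Finset (Fin p) with (S.card : ℝ) ≤ κ * (supp b₀).card,
        ENNReal.ofReal (modelWeight lam pr S) * modelMass X b₀ e t S
          (farSet b₀ (M * (supp b₀).card * Real.sqrt (Real.log p) / colNorm X))
      ≤ ENNReal.ofReal (if (supp b₀).card = 0 then 0 else
          (4 : ℝ) ^ (κ * (supp b₀).card) * Real.exp (-(N * (supp b₀).card * Real.log p))) := by
  set R := M * (supp b₀).card * Real.sqrt (Real.log p) / colNorm X
  have hpr : ∀ S : Finset (Fin p), 0 ≤ pr S.card := fun S =>
    hprior.1 _ (by simpa using S.card_le_univ)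
  have hlog : 0 < Real.log p := Real.log_pos (by exact_mod_cast hp)
  have hell : 0 < Real.sqrt (Real.log p) := Real.sqrt_pos.2 hlog
  have hmass : ∀ S : Finset (Fin p), (S.card : ℝ) ≤ κ * (supp b₀).card →
      ∀ b : EuclideanSpace ℝ S, embed S b ∈ farSet b₀ R →
      relDensity X b₀ e t (embed S b) ≤ Real.exp (-(N * (supp b₀).card * Real.log p))
        * Real.exp (-(colNorm X * Real.sqrt (Real.log p)
          * l1On Finset.univ (embed S b - b₀)))
      ∧ (supp b₀).card ≠ 0 := fun S hS b hb =>
    relDensity_le_of_mem_farSet hc hκ hM hN hNM hx (by omega) he ht htl hcompat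
      (le_trans (by exact_mod_cast Finset.card_le_card (supp_embed_subset S b)) hS) hb
  have hbound : ∀ S ∈ Finset.univ.filter fun S : Finset (Fin p) =>
      (S.card : ℝ) ≤ κ * (supp b₀).card,
      ENNReal.ofReal (modelWeight lam pr S) * modelMass X b₀ e t S (farSet b₀ R)
        ≤ ENNReal.ofReal (pr S.card / (p.choose S.card : ℝ) * (if (supp b₀).card = 0 then 0 else
          (4 : ℝ) ^ (κ * (supp b₀).card)
            * Real.exp (-(N * (supp b₀).card * Real.log p)))) := by
    intro S hS
    replace hS := (Finset.mem_filter.1 hS).2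
    have hprS := hpr S
    rw [modelMass_eq _ _ _ _ _ (measurableSet_farSet R)]
    have hms := measurable_embed S (measurableSet_farSet (b₀ := b₀) R)
    split_ifs with h0
    · have hempty : embed S ⁻¹' farSet b₀ R = ∅ := by
        by_contra hne
        obtain ⟨b, hb⟩ := Set.nonempty_iff_ne_empty.2 hne
        exact (hmass S hS b hb).2 h0
      simp [hempty]
    · have h1 : ∫⁻ b in embed S ⁻¹' farSet b₀ R,
          ENNReal.ofReal (relDensity X b₀ e t (embed S b))
          ≤ ENNReal.ofReal (Real.exp (-(N * (supp b₀).card * Real.log p))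
            * (2 / (colNorm X * Real.sqrt (Real.log p))) ^ S.card) := by
        refine le_trans (setLIntegral_mono' hms fun b hb =>
          ENNReal.ofReal_le_ofReal (hmass S hS b hb).1) ?_
        refine (setLIntegral_le_lintegral _ _).trans ?_
        exact lintegral_exp_neg_l1_embed_sub_le (by positivity) (Real.exp_pos _).le S
      refine (mul_le_mul_right h1 _).trans ?_
      rw [← ENNReal.ofReal_mul (by unfold modelWeight; positivity)]
      refine ENNReal.ofReal_le_ofReal ?_
      rw [modelWeight]
      have h2 : (lam / 2) ^ S.card * (2 / (colNorm X * Real.sqrt (Real.log p))) ^ S.card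
          ≤ (4 : ℝ) ^ (κ * (supp b₀).card) := by
        rw [← mul_pow]
        calc _ ≤ (4 : ℝ) ^ S.card := by
              refine pow_le_pow_left₀ (by positivity) ?_ _
              rw [div_mul_div_comm, div_le_iff₀ (by positivity)]
              rw [lamBar] at hlam2
              linarith
          _ = (4 : ℝ) ^ (S.card : ℝ) := (Real.rpow_natCast _ _).symm
          _ ≤ _ := Real.rpow_le_rpow_of_exponent_le (by norm_num) hS
      calc _ = pr S.card / (p.choose S.card : ℝ) * (((lam / 2) ^ S.card
            * (2 / (colNorm X * Real.sqrt (Real.log p))) ^ S.card)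
            * Real.exp (-(N * (supp b₀).card * Real.log p))) := by ring
        _ ≤ _ := by gcongr
  have hnn : (0 : ℝ) ≤ if (supp b₀).card = 0 then 0 else (4 : ℝ) ^ (κ * (supp b₀).card)
      * Real.exp (-(N * (supp b₀).card * Real.log p)) := by
    split_ifs
    · exact le_rfl
    · positivity
  refine (Finset.sum_le_sum hbound).trans ?_
  rw [← ENNReal.ofReal_sum_of_nonneg fun S _ => by have := hpr S; positivity]
  refine ENNReal.ofReal_le_ofReal ?_
  refine (Finset.sum_le_sum_of_subset_of_nonneg (Finset.filter_subset _ _) fun S _ _ => by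
    have := hpr S; positivity).trans ?_
  rw [← Finset.sum_mul, sum_div_choose_eq, hprior.2, one_mul]

end Contraction

/-! ### The expected posterior mass of large models -/

section Dimension

variable {c δ : ℝ}

/-- The left side is the exponent left after integrating out the noise in `lintegral_relDensity_le`.
With `u` and `v` the `ℓ¹` norms of `b - b₀` on and off the support, and `α = lam / (2 * lamBar X)`,
the linear terms add up to at most `λ (3u - v) / 2`, and a quadratic term `-(α / 2) ‖X(b - b₀)‖²` is
left to control them. -/
lemma tilted_exponent_le (hc : 0 < c) (hx : 0 < colNorm X) (hp : 2 ≤ p) (hlam : 0 < lam)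
    (hlam2 : lam ≤ 2 * lamBar X) (hδ0 : 0 ≤ δ)
    (hδ : (supp b₀).card * lam * Real.sqrt (Real.log p) / colNorm X ≤ δ)
    (hcompat : ENNReal.ofReal c ≤ compat X (supp b₀)) (b : EuclideanSpace ℝ (Fin p)) :
    (1 - lam / (2 * lamBar X)) ^ 2 * ‖apply X (b - b₀)‖ ^ 2 / 2 - ‖apply X (b - b₀)‖ ^ 2 / 2
        + lam / (2 * lamBar X) * (lamBar X * l1On Finset.univ (b - b₀))
        + lam * (l1On Finset.univ b₀ - l1On Finset.univ b)
      ≤ 49 / 8 * δ / c ^ 2 - lam / 4 * l1On Finset.univ (b - b₀) := by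
  have hlog : 0 < Real.log p := Real.log_pos (by exact_mod_cast hp)
  have hell : 0 < Real.sqrt (Real.log p) := Real.sqrt_pos.2 hlog
  have hbar : 0 < lamBar X := by unfold lamBar; positivity
  have hdiff : l1On Finset.univ b₀ - l1On Finset.univ b
      ≤ l1On (supp b₀) (b - b₀) - l1On (supp b₀)ᶜ (b - b₀) := by
    rw [← l1On_add_compl (supp b₀) b₀, ← l1On_add_compl (supp b₀) b]
    have h1 := l1On_sub_le (supp b₀) b₀ b
    rw [l1On_sub_comm] at h1
    have hz : ∀ i ∈ (supp b₀)ᶜ, b₀ i = 0 := fun i hi => by simpa [supp] using hi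
    have h2 : l1On (supp b₀)ᶜ b₀ = 0 := Finset.sum_eq_zero fun i hi => by
      rw [hz i hi, abs_zero]
    have h3 : l1On (supp b₀)ᶜ (b - b₀) = l1On (supp b₀)ᶜ b := Finset.sum_congr rfl fun i hi => by
      rw [PiLp.sub_apply, hz i hi, sub_zero]
    rw [h2, h3]
    linarith
  have hcone := le_norm_apply_of_compat hx hcompat (b := b - b₀)
  rw [← l1On_add_compl (supp b₀) (b - b₀)]
  have hu := l1On_nonneg (supp b₀) (b - b₀)
  have hv := l1On_nonneg (supp b₀)ᶜ (b - b₀)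
  set u := l1On (supp b₀) (b - b₀)
  set v := l1On (supp b₀)ᶜ (b - b₀)
  set Q := ‖apply X (b - b₀)‖
  set α := lam / (2 * lamBar X) with hα
  have hα0 : 0 < α := by positivity
  have hα1 : α ≤ 1 := by rw [hα, div_le_one (by positivity)]; exact hlam2
  have hαl : α * (lamBar X * (u + v)) = lam / 2 * (u + v) := by rw [hα]; field_simp
  have h1 : (1 - α) ^ 2 * Q ^ 2 / 2 - Q ^ 2 / 2 ≤ -(α / 2 * Q ^ 2) := by
    have : 0 ≤ α * (1 - α) * Q ^ 2 := mul_nonneg (mul_nonneg hα0.le (by linarith)) (sq_nonneg Q)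
    nlinarith
  have h2 : lam * (l1On Finset.univ b₀ - l1On Finset.univ b) ≤ lam * (u - v) :=
    mul_le_mul_of_nonneg_left hdiff hlam.le
  have hd : 0 ≤ 49 / 8 * δ / c ^ 2 := by positivity
  suffices h : 3 / 2 * (lam * u) - lam * v / 2 - α / 2 * Q ^ 2
      ≤ 49 / 8 * δ / c ^ 2 - lam / 4 * (u + v) by
    rw [hαl]
    linarith
  have hlu : 0 ≤ lam * u := by positivity
  have hlv : 0 ≤ lam * v := by positivity
  have hQ0 : 0 ≤ α / 2 * Q ^ 2 := by positivity
  rcases lt_or_ge (7 * u) v with h7 | h7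
  · have : lam * (7 * u) ≤ lam * v := by gcongr
    linarith
  · have hsq : (c * (colNorm X * u)) ^ 2 ≤ Q ^ 2 * (supp b₀).card := by
      have := pow_le_pow_left₀ (by positivity) (hcone h7) 2
      rwa [mul_pow Q, Real.sq_sqrt (by positivity)] at this
    suffices h : 7 / 4 * (lam * u) - α / 2 * Q ^ 2 ≤ 49 / 8 * δ / c ^ 2 by linarith
    set s : ℝ := ((supp b₀).card : ℝ) with hs
    have hs0 : 0 ≤ s := by positivity
    rcases hs0.eq_or_lt with h0 | h0
    · have hu0 : u = 0 := by
        rw [← h0, mul_zero] at hsq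
        have := pow_eq_zero_iff (two_ne_zero) |>.1 (le_antisymm hsq (sq_nonneg _))
        simpa [hc.ne', hx.ne'] using this
      rw [hu0]
      linarith
    · set x := colNorm X
      set ell := Real.sqrt (Real.log p)
      have hAQ : lam * c ^ 2 * x / (8 * ell * s) * u ^ 2 ≤ α / 2 * Q ^ 2 := by
        have h3 : (c * (x * u)) ^ 2 / s ≤ Q ^ 2 := by rwa [div_le_iff₀ h0]
        calc _ = α / 2 * ((c * (x * u)) ^ 2 / s) := by
              rw [hα, show lamBar X = 2 * x * ell from rfl]
              field_simp
              ring
          _ ≤ _ := by gcongr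
      -- Maximizing the quadratic polynomial in `u` gives the constant `49 / 8`; the gap is a
      -- square.
      have hamgm : 7 / 4 * (lam * u) - lam * c ^ 2 * x / (8 * ell * s) * u ^ 2
          ≤ 49 / 8 * (s * lam * ell / x) / c ^ 2 := by
        have h4 : 49 / 8 * (s * lam * ell / x) / c ^ 2 - (7 / 4 * (lam * u)
            - lam * c ^ 2 * x / (8 * ell * s) * u ^ 2)
            = lam * (c ^ 2 * x * u - 7 * ell * s) ^ 2 / (8 * ell * s * c ^ 2 * x) := by
          field_simp
          ring
        have h5 : 0 ≤ lam * (c ^ 2 * x * u - 7 * ell * s) ^ 2 / (8 * ell * s * c ^ 2 * x) := by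
          positivity
        linarith
      have h6 : 49 / 8 * (s * lam * ell / x) / c ^ 2 ≤ 49 / 8 * δ / c ^ 2 := by gcongr
      linarith

lemma measurable_uncurry_relDensity_embed (S : Finset (Fin p)) (t : ℝ) :
    Measurable (Function.uncurry fun (e : EuclideanSpace ℝ (Fin n)) (b : EuclideanSpace ℝ S) =>
      ENNReal.ofReal (relDensity X b₀ e t (embed S b))) := by
  unfold relDensity
  have h1 : Measurable fun z : EuclideanSpace ℝ (Fin n) × EuclideanSpace ℝ S => embed S z.2 :=
    (measurable_embed S).comp measurable_snd
  have h2 : Measurable fun z : EuclideanSpace ℝ (Fin n) × EuclideanSpace ℝ S =>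
      apply X (embed S z.2 - b₀) := (measurable_apply X).comp (by fun_prop)
  have h3 : Measurable fun z : EuclideanSpace ℝ (Fin n) × EuclideanSpace ℝ S =>
      l1On Finset.univ (embed S z.2) := (measurable_l1On _).comp h1
  simp only [Function.uncurry_def]
  fun_prop

lemma measurable_modelMass_univ (S : Finset (Fin p)) (t : ℝ) :
    Measurable fun e : EuclideanSpace ℝ (Fin n) => modelMass X b₀ e t S Set.univ := by
  simp_rw [modelMass_eq _ _ _ _ _ MeasurableSet.univ, Set.preimage_univ, setLIntegral_univ]
  exact (measurable_uncurry_relDensity_embed S t).lintegral_prod_right'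

/-- Integrating out the whole noise term would cancel the quadratic term, and bounding all of it on
the event would cost `λ̄ ‖b - b₀‖₁`, too much for the penalty. Bounding the fraction `α = λ / (2
λ̄)` costs only half the penalty rate and still saves a part of the quadratic term. -/
lemma lintegral_relDensity_le (hc : 0 < c) (hx : 0 < colNorm X) (hp : 2 ≤ p) (hlam : 0 < lam)
    (hlam2 : lam ≤ 2 * lamBar X) (hδ0 : 0 ≤ δ)
    (hδ : (supp b₀).card * lam * Real.sqrt (Real.log p) / colNorm X ≤ δ)
    (hcompat : ENNReal.ofReal c ≤ compat X (supp b₀)) (b : EuclideanSpace ℝ (Fin p)) :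
    ∫⁻ e in noiseEvent X, ENNReal.ofReal (relDensity X b₀ e lam b)
        ∂(stdGaussian (EuclideanSpace ℝ (Fin n)))
      ≤ ENNReal.ofReal (Real.exp (49 / 8 * δ / c ^ 2)
        * Real.exp (-(lam / 4 * l1On Finset.univ (b - b₀)))) := by
  have hlog : 0 < Real.log p := Real.log_pos (by exact_mod_cast hp)
  have hell : 0 < Real.sqrt (Real.log p) := Real.sqrt_pos.2 hlog
  have hbar : 0 < lamBar X := by unfold lamBar; positivity
  have htilt := tilted_exponent_le hc hx hp hlam hlam2 hδ0 hδ hcompat b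
  set d := apply X (b - b₀) with hd
  set α := lam / (2 * lamBar X) with hα
  have hα0 : 0 < α := by positivity
  have hα1 : α ≤ 1 := by rw [hα, div_le_one (by positivity)]; exact hlam2
  set C := -(‖d‖ ^ 2 / 2) + α * (lamBar X * l1On Finset.univ (b - b₀))
    + lam * (l1On Finset.univ b₀ - l1On Finset.univ b) with hC
  calc _ ≤ ∫⁻ e in noiseEvent X, ENNReal.ofReal (Real.exp C)
        * ENNReal.ofReal (Real.exp (inner ℝ ((1 - α) • d) e))
        ∂(stdGaussian (EuclideanSpace ℝ (Fin n))) := by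
        refine setLIntegral_mono' (measurableSet_noiseEvent X) fun e he => ?_
        rw [← ENNReal.ofReal_mul (Real.exp_pos _).le, ← Real.exp_add, relDensity]
        refine ENNReal.ofReal_le_ofReal (Real.exp_le_exp.2 ?_)
        have h1 := mul_le_mul_of_nonneg_left (inner_apply_le he (b - b₀)) hα0.le
        rw [← hd] at h1 ⊢
        rw [real_inner_smul_left, real_inner_comm, hC]
        rw [real_inner_comm] at h1
        linarith
    _ ≤ ∫⁻ e, ENNReal.ofReal (Real.exp C)
        * ENNReal.ofReal (Real.exp (inner ℝ ((1 - α) • d) e))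
        ∂(stdGaussian (EuclideanSpace ℝ (Fin n))) := setLIntegral_le_lintegral _ _
    _ = ENNReal.ofReal (Real.exp (C + ‖(1 - α) • d‖ ^ 2 / 2)) := by
        rw [lintegral_const_mul _ (by fun_prop), lintegral_exp_inner_stdGaussian,
          ← ENNReal.ofReal_mul (Real.exp_pos _).le, ← Real.exp_add]
    _ ≤ _ := by
        rw [← Real.exp_add]
        refine ENNReal.ofReal_le_ofReal (Real.exp_le_exp.2 ?_)
        rw [norm_smul, mul_pow, Real.norm_eq_abs, sq_abs, hC]
        linarith

/-- By Tonelli only a Laplace integral with rate `λ / 4` remains. Its power of `λ` cancels against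
the prior's, leaving `4 ^ |S|` in the sum over models. -/
lemma lintegral_modelMass_le (hc : 0 < c) (hx : 0 < colNorm X) (hp : 2 ≤ p) (hlam : 0 < lam)
    (hlam2 : lam ≤ 2 * lamBar X) (hδ0 : 0 ≤ δ)
    (hδ : (supp b₀).card * lam * Real.sqrt (Real.log p) / colNorm X ≤ δ)
    (hcompat : ENNReal.ofReal c ≤ compat X (supp b₀)) (S : Finset (Fin p)) :
    ∫⁻ e in noiseEvent X, modelMass X b₀ e lam S Set.univ
        ∂(stdGaussian (EuclideanSpace ℝ (Fin n)))
      ≤ ENNReal.ofReal (Real.exp (49 / 8 * δ / c ^ 2) * (8 / lam) ^ S.card) := by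
  simp_rw [modelMass_eq _ _ _ _ _ MeasurableSet.univ, Set.preimage_univ, setLIntegral_univ]
  rw [lintegral_lintegral_swap (measurable_uncurry_relDensity_embed S lam).aemeasurable]
  refine (lintegral_mono fun b =>
    lintegral_relDensity_le hc hx hp hlam hlam2 hδ0 hδ hcompat (embed S b)).trans ?_
  refine (lintegral_exp_neg_l1_embed_sub_le (by positivity) (Real.exp_pos _).le S).trans
    (le_of_eq ?_)
  congr 3
  field_simp
  norm_num

lemma lintegral_sum_modelMass_le (hc : 0 < c) (hx : 0 < colNorm X) (hp : 2 ≤ p) (hlam : 0 < lam)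
    (hlam2 : lam ≤ 2 * lamBar X) (hδ0 : 0 ≤ δ)
    (hδ : (supp b₀).card * lam * Real.sqrt (Real.log p) / colNorm X ≤ δ)
    (hcompat : ENNReal.ofReal c ≤ compat X (supp b₀)) (hpr : ∀ s ≤ p, 0 ≤ pr s) (K : ℝ) :
    ∫⁻ e in noiseEvent X, ∑ S : Finset (Fin p) with ¬ (S.card : ℝ) ≤ K,
        ENNReal.ofReal (modelWeight lam pr S) * modelMass X b₀ e lam S Set.univ
        ∂(stdGaussian (EuclideanSpace ℝ (Fin n)))
      ≤ ENNReal.ofReal (Real.exp (49 / 8 * δ / c ^ 2)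
        * ∑ s ∈ Finset.range (p + 1) with ¬ ((s : ℕ) : ℝ) ≤ K, pr s * 4 ^ s) := by
  have hprS : ∀ S : Finset (Fin p), 0 ≤ pr S.card := fun S =>
    hpr _ (by simpa using S.card_le_univ)
  rw [lintegral_finsetSum _ fun S _ => (measurable_modelMass_univ S lam).const_mul _]
  set f : ℕ → ℝ := fun s => if ¬ (s : ℝ) ≤ K then pr s * 4 ^ s else 0 with hf
  have hterm : ∀ S : Finset (Fin p), S ∈ Finset.univ.filter
      (fun S : Finset (Fin p) => ¬ (S.card : ℝ) ≤ K) →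
      ∫⁻ e in noiseEvent X, ENNReal.ofReal (modelWeight lam pr S)
        * modelMass X b₀ e lam S Set.univ ∂(stdGaussian (EuclideanSpace ℝ (Fin n)))
      ≤ ENNReal.ofReal (Real.exp (49 / 8 * δ / c ^ 2)
        * (f S.card / (p.choose S.card : ℝ))) := by
    intro S hS
    have h0 := hprS S
    rw [lintegral_const_mul _ (measurable_modelMass_univ S lam)]
    refine (mul_le_mul_right
      (lintegral_modelMass_le hc hx hp hlam hlam2 hδ0 hδ hcompat S) _).trans ?_
    rw [← ENNReal.ofReal_mul (by unfold modelWeight; positivity)]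
    refine ENNReal.ofReal_le_ofReal (le_of_eq ?_)
    have h4 : (lam / 2) ^ S.card * (8 / lam) ^ S.card = 4 ^ S.card := by
      rw [← mul_pow]; congr 1; field_simp; norm_num
    simp only [hf, (Finset.mem_filter.1 hS).2, if_pos, not_false_eq_true, modelWeight]
    rw [← h4]; ring
  have hf0 : ∀ S : Finset (Fin p), 0 ≤ f S.card := by
    intro S
    have := hprS S
    simp only [hf]
    split_ifs
    · exact le_rfl
    · positivity
  refine (Finset.sum_le_sum hterm).trans ?_
  rw [← ENNReal.ofReal_sum_of_nonneg fun S _ => by have := hf0 S; positivity, ← Finset.mul_sum]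
  refine ENNReal.ofReal_le_ofReal (mul_le_mul_of_nonneg_left ?_ (Real.exp_pos _).le)
  refine (Finset.sum_le_sum_of_subset_of_nonneg (Finset.filter_subset _ _) fun S _ _ => by
    have := hf0 S; positivity).trans (le_of_eq ?_)
  rw [sum_div_choose_eq, Finset.sum_filter]

end Dimension

end

section

variable {n p : ℕ} {X : Matrix (Fin n) (Fin p) ℝ} {b₀ : EuclideanSpace ℝ (Fin p)}
  {e : EuclideanSpace ℝ (Fin n)} {lam : ℝ} {pr : ℕ → ℝ}

/-! ### Comparison of the posterior with its limit -/

section Comparison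

variable {κ M : ℝ}

lemma modelMass_mono (t : ℝ) (S : Finset (Fin p)) {B B' : Set (EuclideanSpace ℝ (Fin p))}
    (h : B ⊆ B') : modelMass X b₀ e t S B ≤ modelMass X b₀ e t S B' :=
  lintegral_mono_set h

lemma modelMass_le_add_sdiff (t : ℝ) (S : Finset (Fin p)) (B F : Set (EuclideanSpace ℝ (Fin p))) :
    modelMass X b₀ e t S B ≤ modelMass X b₀ e t S F + modelMass X b₀ e t S (B \ F) := by
  refine (modelMass_mono t S (B' := F ∪ B \ F) ?_).trans (lintegral_union_le _ _ _)
  rw [Set.union_sdiff_self]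
  exact Set.subset_union_right

/-- Within distance `R` of `b₀` the `ℓ¹` norm varies by at most `R`. With the rates `lam` and `0`
this removes the penalty at the price of a factor `e^r`, which tends to one in the small lambda
regime. -/
lemma modelMass_sdiff_farSet_le {t t' R r : ℝ} (htt : |t - t'| * R ≤ r)
    (S : Finset (Fin p)) {B : Set (EuclideanSpace ℝ (Fin p))} (hB : MeasurableSet B) :
    modelMass X b₀ e t S (B \ farSet b₀ R)
      ≤ ENNReal.ofReal (Real.exp r) * modelMass X b₀ e t' S B := by
  refine le_trans ?_ (mul_le_mul_right
    (modelMass_mono t' S (Set.sdiff_subset : B \ farSet b₀ R ⊆ B)) _)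
  rw [modelMass, modelMass, ← lintegral_const_mul' _ _ ENNReal.ofReal_ne_top]
  refine setLIntegral_mono' (hB.diff (measurableSet_farSet R)) fun b hb => ?_
  rw [← ENNReal.ofReal_mul (Real.exp_pos _).le, relDensity, relDensity, ← Real.exp_add]
  refine ENNReal.ofReal_le_ofReal (Real.exp_le_exp.2 ?_)
  have hR : l1On Finset.univ (b - b₀) ≤ R := not_lt.1 hb.2
  have h1 := l1On_sub_le Finset.univ b₀ b
  have h2 := l1On_sub_le Finset.univ b b₀
  rw [l1On_sub_comm] at h1
  have h3 : |l1On Finset.univ b₀ - l1On Finset.univ b| ≤ R := abs_le.2 ⟨by linarith, by linarith⟩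
  have h4 : (t - t') * (l1On Finset.univ b₀ - l1On Finset.univ b) ≤ r := by
    refine (le_abs_self _).trans ?_
    rw [abs_mul]
    exact (mul_le_mul_of_nonneg_left h3 (abs_nonneg _)).trans htt
  linarith

/-- On the model `S` every vector differs from `b₀` by `-b₀` off `S`; outside the neighbourhood this
alone makes it far. -/
lemma modelMass_sdiff_farSet_eq_zero {t : ℝ} {S : Finset (Fin p)}
    (hS : (S.card : ℝ) ≤ κ * (supp b₀).card) (hS' : S ∉ nbhdModels X κ M b₀)
    {B : Set (EuclideanSpace ℝ (Fin p))} (hB : MeasurableSet B) :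
    modelMass X b₀ e t S
      (B \ farSet b₀ (M * (supp b₀).card * Real.sqrt (Real.log p) / colNorm X)) = 0 := by
  rw [modelMass_eq _ _ _ _ _ (hB.diff (measurableSet_farSet _))]
  have hempty : embed S ⁻¹'
      (B \ farSet b₀ (M * (supp b₀).card * Real.sqrt (Real.log p) / colNorm X)) = ∅ := by
    refine Set.eq_empty_iff_forall_notMem.2 fun b hb => hb.2 ?_
    have h1 : M * (supp b₀).card * Real.sqrt (Real.log p) / colNorm X < l1On Sᶜ b₀ := by
      by_contra hcon
      exact hS' (Finset.mem_filter.2 ⟨Finset.mem_univ _, hS, not_lt.1 hcon⟩)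
    have h2 : l1On Sᶜ b₀ = l1On Sᶜ (embed S b - b₀) := Finset.sum_congr rfl fun i hi => by
      rw [PiLp.sub_apply, embed_apply_of_notMem S b (Finset.mem_compl.1 hi), zero_sub, abs_neg]
    exact lt_of_lt_of_le (h2 ▸ h1) (l1On_mono (Finset.subset_univ _) _)
  simp [hempty]

lemma nbhdModels_subset : nbhdModels X κ M b₀
    ⊆ Finset.univ.filter fun S : Finset (Fin p) => (S.card : ℝ) ≤ κ * (supp b₀).card := by
  intro S hS
  exact Finset.mem_filter.2 ⟨Finset.mem_univ _, (Finset.mem_filter.1 hS).2.1⟩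

lemma sum_modelMass_le {H : ℝ≥0∞} {r : ℝ}
    (hfar : ∑ S : Finset (Fin p) with (S.card : ℝ) ≤ κ * (supp b₀).card,
        ENNReal.ofReal (modelWeight lam pr S) * modelMass X b₀ e lam S
          (farSet b₀ (M * (supp b₀).card * Real.sqrt (Real.log p) / colNorm X)) ≤ H)
    (hr : |lam| * (M * (supp b₀).card * Real.sqrt (Real.log p) / colNorm X) ≤ r)
    {B : Set (EuclideanSpace ℝ (Fin p))} (hB : MeasurableSet B) :
    ∑ S, ENNReal.ofReal (modelWeight lam pr S) * modelMass X b₀ e lam S B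
      ≤ (∑ S : Finset (Fin p) with ¬ (S.card : ℝ) ≤ κ * (supp b₀).card,
          ENNReal.ofReal (modelWeight lam pr S) * modelMass X b₀ e lam S Set.univ) + H
        + ENNReal.ofReal (Real.exp r) * ∑ S ∈ nbhdModels X κ M b₀,
          ENNReal.ofReal (modelWeight lam pr S) * modelMass X b₀ e 0 S B := by
  set R := M * (supp b₀).card * Real.sqrt (Real.log p) / colNorm X with hR
  rw [← Finset.sum_filter_add_sum_filter_not Finset.univ
    fun S : Finset (Fin p) => (S.card : ℝ) ≤ κ * (supp b₀).card, add_comm, add_assoc]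
  refine add_le_add (Finset.sum_le_sum fun S _ =>
    mul_le_mul_right (modelMass_mono _ S (Set.subset_univ _)) _) ?_
  calc _ ≤ ∑ S : Finset (Fin p) with (S.card : ℝ) ≤ κ * (supp b₀).card,
          (ENNReal.ofReal (modelWeight lam pr S) * modelMass X b₀ e lam S (farSet b₀ R)
          + ENNReal.ofReal (modelWeight lam pr S)
            * modelMass X b₀ e lam S (B \ farSet b₀ R)) := by
        refine Finset.sum_le_sum fun S _ => ?_
        rw [← mul_add]
        exact mul_le_mul_right (modelMass_le_add_sdiff lam S B _) _
    _ ≤ _ := by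
        rw [Finset.sum_add_distrib]
        refine add_le_add hfar ?_
        rw [← Finset.sum_subset nbhdModels_subset fun S hS hS' => ?_, Finset.mul_sum]
        · refine Finset.sum_le_sum fun S _ => ?_
          rw [mul_left_comm]
          exact mul_le_mul_right
            (modelMass_sdiff_farSet_le (by rwa [sub_zero]) S hB) _
        · rw [modelMass_sdiff_farSet_eq_zero (Finset.mem_filter.1 hS).2 hS' hB, mul_zero]

/-- The reverse comparison, needed only for total masses: it controls the ratio of the normalizing
constants. -/
lemma sum_nbhd_modelMass_le {H : ℝ≥0∞} {r : ℝ}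
    (hfar : ∑ S : Finset (Fin p) with (S.card : ℝ) ≤ κ * (supp b₀).card,
        ENNReal.ofReal (modelWeight lam pr S) * modelMass X b₀ e 0 S
          (farSet b₀ (M * (supp b₀).card * Real.sqrt (Real.log p) / colNorm X)) ≤ H)
    (hr : |lam| * (M * (supp b₀).card * Real.sqrt (Real.log p) / colNorm X) ≤ r) :
    ∑ S ∈ nbhdModels X κ M b₀,
        ENNReal.ofReal (modelWeight lam pr S) * modelMass X b₀ e 0 S Set.univ
      ≤ H + ENNReal.ofReal (Real.exp r) * ∑ S,
          ENNReal.ofReal (modelWeight lam pr S) * modelMass X b₀ e lam S Set.univ := by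
  set R := M * (supp b₀).card * Real.sqrt (Real.log p) / colNorm X with hR
  calc _ ≤ ∑ S ∈ nbhdModels X κ M b₀,
          (ENNReal.ofReal (modelWeight lam pr S) * modelMass X b₀ e 0 S (farSet b₀ R)
          + ENNReal.ofReal (modelWeight lam pr S)
            * modelMass X b₀ e 0 S (Set.univ \ farSet b₀ R)) := by
        refine Finset.sum_le_sum fun S _ => ?_
        rw [← mul_add]
        exact mul_le_mul_right (modelMass_le_add_sdiff 0 S _ _) _
    _ ≤ _ := by
        rw [Finset.sum_add_distrib]
        refine add_le_add ((Finset.sum_le_sum_of_subset nbhdModels_subset).trans hfar) ?_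
        rw [Finset.mul_sum]
        refine (Finset.sum_le_sum fun S _ => ?_).trans
          (Finset.sum_le_sum_of_subset (Finset.subset_univ _))
        rw [mul_left_comm]
        exact mul_le_mul_right
          (modelMass_sdiff_farSet_le (by rwa [zero_sub, abs_neg]) S .univ) _

/-- The total variation distance between posterior and limit, for a given realization of the
noise. -/
lemma tvDist_posterior_limit_le {D H η : ℝ≥0∞} {r : ℝ} (hlam : 0 < lam)
    (hpr : ∀ s ≤ p, 0 < pr s) (hG : ∀ S ∈ nbhdModels X κ M b₀, (gram X S).PosDef)
    (hmem : supp b₀ ∈ nbhdModels X κ M b₀) (hD0 : D ≠ 0) (hDtop : D ≠ ∞)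
    (hD : ∀ t, t = 0 ∨ t = lam → D ≤ ENNReal.ofReal (modelWeight lam pr (supp b₀))
        * modelMass X b₀ e t (supp b₀) Set.univ)
    (hfar : ∀ t, t = 0 ∨ t = lam →
      ∑ S : Finset (Fin p) with (S.card : ℝ) ≤ κ * (supp b₀).card,
        ENNReal.ofReal (modelWeight lam pr S) * modelMass X b₀ e t S
          (farSet b₀ (M * (supp b₀).card * Real.sqrt (Real.log p) / colNorm X)) ≤ H)
    (hH : H ≤ η * D)
    (hr : |lam| * (M * (supp b₀).card * Real.sqrt (Real.log p) / colNorm X) ≤ r) :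
    tvDist (posterior X lam pr (apply X b₀ + e)) (limitPosterior X lam pr κ M b₀ (apply X b₀ + e))
      ≤ D⁻¹ * (∑ S : Finset (Fin p) with ¬ (S.card : ℝ) ≤ κ * (supp b₀).card,
          ENNReal.ofReal (modelWeight lam pr S) * modelMass X b₀ e lam S Set.univ) + η
        + (ENNReal.ofReal (Real.exp r) * (η + ENNReal.ofReal (Real.exp r)) - 1) := by
  have hpr0 : ∀ s ≤ p, 0 ≤ pr s := fun s hs => (hpr s hs).le
  set A := ∑ S, ENNReal.ofReal (modelWeight lam pr S) * modelMass X b₀ e lam S Set.univ with hA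
  set C := ∑ S ∈ nbhdModels X κ M b₀,
    ENNReal.ofReal (modelWeight lam pr S) * modelMass X b₀ e 0 S Set.univ with hC
  set big := ∑ S : Finset (Fin p) with ¬ (S.card : ℝ) ≤ κ * (supp b₀).card,
          ENNReal.ofReal (modelWeight lam pr S) * modelMass X b₀ e lam S Set.univ with hbig
  set E := ENNReal.ofReal (Real.exp r) with hE
  have hDA : D ≤ A := (hD lam (Or.inr rfl)).trans
    (Finset.single_le_sum (f := fun S => ENNReal.ofReal (modelWeight lam pr S)
      * modelMass X b₀ e lam S Set.univ) (fun _ _ => zero_le) (Finset.mem_univ _))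
  have hDC : D ≤ C := (hD 0 (Or.inl rfl)).trans
    (Finset.single_le_sum (f := fun S => ENNReal.ofReal (modelWeight lam pr S)
      * modelMass X b₀ e 0 S Set.univ) (fun _ _ => zero_le) hmem)
  have hA0 : A ≠ 0 := fun h => hD0 (le_antisymm (h ▸ hDA) zero_le)
  have hC0 : C ≠ 0 := fun h => hD0 (le_antisymm (h ▸ hDC) zero_le)
  have hAtop : A ≠ ∞ := sum_modelMass_ne_top X b₀ e hlam hpr0
  have hCtop : C ≠ ∞ := sum_nbhd_modelMass_ne_top X b₀ e hlam hpr hG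
  have := isProbabilityMeasure_posterior X b₀ e hlam hpr0 hA0
  have := isProbabilityMeasure_limitPosterior X b₀ e hlam hpr hG ⟨_, hmem⟩ hC0
  have hHA : A⁻¹ * H ≤ η := by
    calc A⁻¹ * H ≤ D⁻¹ * (η * D) := mul_le_mul' (ENNReal.inv_le_inv.2 hDA) hH
      _ = η := by rw [mul_left_comm, ENNReal.inv_mul_cancel hD0 hDtop, mul_one]
  -- One factor `E` comes from this ratio of normalizing constants, the other from comparing the
  -- masses of `B`.
  have hCA : A⁻¹ * C ≤ η + E := by
    calc A⁻¹ * C ≤ A⁻¹ * (H + E * A) :=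
          mul_le_mul_right (sum_nbhd_modelMass_le (hfar 0 (Or.inl rfl)) hr) _
      _ = A⁻¹ * H + E := by
          rw [mul_add, mul_left_comm, ENNReal.inv_mul_cancel hA0 hAtop, mul_one]
      _ ≤ _ := by gcongr
  refine tvDist_le_of_forall_le fun B hB => ?_
  rw [posterior_apply X b₀ e hlam hpr0 hB, limitPosterior_apply X b₀ e hlam hpr hG ⟨_, hmem⟩ hB]
  set q := ∑ S ∈ nbhdModels X κ M b₀,
    ENNReal.ofReal (modelWeight lam pr S) * modelMass X b₀ e 0 S B with hq
  calc _ ≤ A⁻¹ * (big + H + E * q) :=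
        mul_le_mul_right (sum_modelMass_le (hfar lam (Or.inr rfl)) hr hB) _
    _ = A⁻¹ * big + A⁻¹ * H + E * (A⁻¹ * C) * (C⁻¹ * q) := by
        have : C * (C⁻¹ * q) = q := by
          rw [← mul_assoc, ENNReal.mul_inv_cancel hC0 hCtop, one_mul]
        rw [mul_assoc E, mul_assoc A⁻¹ C, this]
        ring
    _ ≤ D⁻¹ * big + η + E * (η + E) * (C⁻¹ * q) := by
        gcongr
    _ ≤ _ := by
        gcongr
        -- Truncated subtraction: `a ≤ 1 + (a - 1)`.
        exact le_add_tsub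

end Comparison

/-! ### The prior on the dimension -/

section DimPrior

variable {A₁ A₂ A₃ A₄ : ℝ}

lemma DimPriorDecay.le_pow (hA₂ : 0 < A₂) (h : DimPriorDecay A₁ A₂ A₃ A₄ p pr) {s r : ℕ}
    (hs : s + r ≤ p) : pr (s + r) ≤ (A₂ * (p : ℝ) ^ (-A₄)) ^ r * pr s := by
  induction r with
  | zero => simp
  | succ r ih =>
    have h1 := (h (s + (r + 1)) (by omega) hs).2
    have h2 := ih (by omega)
    rw [show s + (r + 1) - 1 = s + r by omega] at h1
    calc _ ≤ A₂ * (p : ℝ) ^ (-A₄) * ((A₂ * (p : ℝ) ^ (-A₄)) ^ r * pr s) :=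
          h1.trans (mul_le_mul_of_nonneg_left h2 (by positivity))
      _ = _ := by rw [pow_succ']; ring

lemma DimPriorDecay.pow_le (hA₁ : 0 < A₁) (h : DimPriorDecay A₁ A₂ A₃ A₄ p pr) {s : ℕ}
    (hs : s ≤ p) : (A₁ * (p : ℝ) ^ (-A₃)) ^ s * pr 0 ≤ pr s := by
  induction s with
  | zero => simp
  | succ s ih =>
    have h1 := (h (s + 1) (by omega) hs).1
    rw [Nat.add_sub_cancel] at h1
    refine le_trans ?_ h1
    rw [pow_succ', mul_assoc]
    exact mul_le_mul_of_nonneg_left (ih (by omega)) (by positivity)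

lemma IsDimPrior.zero_pos (hA₂ : 0 < A₂) (hprior : IsDimPrior p pr)
    (h : DimPriorDecay A₁ A₂ A₃ A₄ p pr) : 0 < pr 0 := by
  rcases (hprior.1 0 (Nat.zero_le _)).eq_or_lt with h0 | h0
  · have hz : ∑ s ∈ Finset.range (p + 1), pr s ≤ 0 := Finset.sum_nonpos fun s hs => by
      have := h.le_pow hA₂ (s := 0) (r := s) (by have := Finset.mem_range.1 hs; omega)
      rwa [← h0, mul_zero, zero_add] at this
    rw [hprior.2] at hz
    linarith
  · exact h0

lemma IsDimPrior.pos (hA₁ : 0 < A₁) (hA₂ : 0 < A₂) (hp : 1 ≤ p) (hprior : IsDimPrior p pr)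
    (h : DimPriorDecay A₁ A₂ A₃ A₄ p pr) {s : ℕ} (hs : s ≤ p) : 0 < pr s := by
  have hp0 : (0 : ℝ) < p := by exact_mod_cast hp
  have h0 := hprior.zero_pos hA₂ h
  exact lt_of_lt_of_le (by positivity) (h.pow_le hA₁ hs)

/-- The weights are dominated by a geometric series with ratio `1/2` starting at `pr 0`. -/
lemma IsDimPrior.half_le_zero (hA₂ : 0 < A₂) (hprior : IsDimPrior p pr)
    (h : DimPriorDecay A₁ A₂ A₃ A₄ p pr) (hsmall : A₂ * (p : ℝ) ^ (-A₄) ≤ 1 / 2) :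
    1 ≤ 2 * pr 0 := by
  have h0 := hprior.zero_pos hA₂ h
  calc 1 = ∑ s ∈ Finset.range (p + 1), pr s := hprior.2.symm
    _ ≤ ∑ s ∈ Finset.range (p + 1), (1 / 2 : ℝ) ^ s * pr 0 := by
        refine Finset.sum_le_sum fun s hs => ?_
        have h1 := h.le_pow hA₂ (s := 0) (r := s) (by have := Finset.mem_range.1 hs; omega)
        rw [zero_add] at h1
        refine h1.trans ?_
        gcongr
    _ ≤ 2 * pr 0 := by
        rw [← Finset.sum_mul]
        exact mul_le_mul_of_nonneg_right (sum_geometric_two_le _) h0.le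

/-- The geometric ratio in the bound on the posterior mass of large models. -/
def dimRatio (A₂ A₄ : ℝ) (p : ℕ) : ℝ :=
  A₂ * (p : ℝ) ^ (-A₄) * 4 * (4 * (Real.exp 1 * (p : ℝ) ^ 2)) ^ (A₄ / 3)

/-- If `s > κ s₀`, the excess `s - s₀` is more than `3 s₀ / A₄`. Hence the factor `(4 e p²)^s₀`,
paid for the lower bound and for `4^s₀`, can be spread over the excess dimensions at `(4 e p²)^(A₄ /
3)` each, of order `p^(2 A₄ / 3)`, which the prior decay `p^(-A₄)` overcomes. -/
lemma sum_large_le (hA₂ : 0 < A₂) (hA₄ : 0 < A₄) (hp : 1 ≤ p) (hpr : ∀ s ≤ p, 0 ≤ pr s)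
    (h : DimPriorDecay A₁ A₂ A₃ A₄ p pr) (hq : dimRatio A₂ A₄ p ≤ 1 / 2) {κ : ℝ}
    (hκ : 1 + 3 / A₄ ≤ κ) {s₀ : ℕ} (hs₀ : s₀ ≤ p) :
    ∑ s ∈ Finset.range (p + 1) with ¬ ((s : ℕ) : ℝ) ≤ κ * s₀, pr s * 4 ^ s
      ≤ 2 * dimRatio A₂ A₄ p * (pr s₀ * ((Real.exp 1 * (p : ℝ) ^ 2) ^ s₀)⁻¹) := by
  set q := dimRatio A₂ A₄ p with hqdef
  set B := pr s₀ * ((Real.exp 1 * (p : ℝ) ^ 2) ^ s₀)⁻¹ with hB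
  have hp1 : (1 : ℝ) ≤ p := by exact_mod_cast hp
  have hp0 : (0 : ℝ) < p := by linarith
  have hq0 : 0 ≤ q := by rw [hqdef, dimRatio]; positivity
  have hB0 : 0 ≤ B := by have := hpr s₀ hs₀; positivity
  have hκ1 : (s₀ : ℝ) ≤ κ * s₀ := by
    have : 1 ≤ κ := le_trans (by have : 0 < 3 / A₄ := by positivity
                                 linarith) hκ
    nlinarith [(Nat.cast_nonneg s₀ : (0 : ℝ) ≤ s₀)]
  -- The excess is at least one, hence `r + 1`: one factor `q` is kept outside the geometric series
  -- and makes the whole sum small.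
  have hterm : ∀ r : ℕ, s₀ + (r + 1) ≤ p → κ * s₀ < (s₀ + (r + 1) : ℕ) →
      pr (s₀ + (r + 1)) * 4 ^ (s₀ + (r + 1)) ≤ B * (q * (1 / 2) ^ r) := by
    intro r hr hlt
    have h1 := h.le_pow hA₂ hr
    have hbase : 1 ≤ 4 * (Real.exp 1 * (p : ℝ) ^ 2) := by
      have h2 : 1 ≤ Real.exp 1 := Real.one_le_exp (by norm_num)
      have h3 : 1 ≤ (p : ℝ) ^ 2 := one_le_pow₀ hp1
      nlinarith
    have hexp : (s₀ : ℝ) ≤ A₄ / 3 * (r + 1 : ℕ) := by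
      have h2 : (1 + 3 / A₄) * s₀ ≤ κ * s₀ := by gcongr
      have h3 : 3 / A₄ * s₀ ≤ (r + 1 : ℕ) := by
        push_cast at hlt ⊢
        linarith
      calc (s₀ : ℝ) = A₄ / 3 * (3 / A₄ * s₀) := by field_simp
        _ ≤ _ := by gcongr
    have hpow : (4 * (Real.exp 1 * (p : ℝ) ^ 2)) ^ s₀
        ≤ ((4 * (Real.exp 1 * (p : ℝ) ^ 2)) ^ (A₄ / 3)) ^ (r + 1) := by
      rw [← Real.rpow_natCast _ s₀, ← Real.rpow_natCast _ (r + 1), ← Real.rpow_mul (by positivity)]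
      exact Real.rpow_le_rpow_of_exponent_le hbase hexp
    have hprs := hpr s₀ hs₀
    calc pr (s₀ + (r + 1)) * 4 ^ (s₀ + (r + 1))
        ≤ (A₂ * (p : ℝ) ^ (-A₄)) ^ (r + 1) * pr s₀ * 4 ^ (s₀ + (r + 1)) := by gcongr
      _ = B * ((A₂ * (p : ℝ) ^ (-A₄) * 4) ^ (r + 1)
          * (4 * (Real.exp 1 * (p : ℝ) ^ 2)) ^ s₀) := by
          have hne : (Real.exp 1 * (p : ℝ) ^ 2) ^ s₀ ≠ 0 := by positivity
          rw [hB, pow_add 4, mul_pow (A₂ * (p : ℝ) ^ (-A₄)) 4, mul_pow 4]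
          field_simp
      _ ≤ B * ((A₂ * (p : ℝ) ^ (-A₄) * 4) ^ (r + 1)
          * ((4 * (Real.exp 1 * (p : ℝ) ^ 2)) ^ (A₄ / 3)) ^ (r + 1)) := by gcongr
      _ = B * q ^ (r + 1) := by rw [← mul_pow, hqdef, dimRatio]
      _ ≤ B * (q * (1 / 2) ^ r) := by rw [pow_succ']; gcongr
  calc _ ≤ ∑ s ∈ Finset.Ico (s₀ + 1) (p + 1), B * (q * (1 / 2 : ℝ) ^ (s - (s₀ + 1))) := by
        refine (Finset.sum_le_sum (g := fun s => B * (q * (1 / 2 : ℝ) ^ (s - (s₀ + 1))))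
          fun s hs => ?_).trans (Finset.sum_le_sum_of_subset_of_nonneg ?_ fun _ _ _ => by positivity)
        · obtain ⟨hs1, hs2⟩ := Finset.mem_filter.1 hs
          have hs1 := Finset.mem_range.1 hs1
          rw [not_le] at hs2
          have hlt : s₀ < s := by exact_mod_cast lt_of_le_of_lt hκ1 hs2
          obtain ⟨r, rfl⟩ : ∃ r, s = s₀ + (r + 1) := ⟨s - s₀ - 1, by omega⟩
          rw [show s₀ + (r + 1) - (s₀ + 1) = r by omega]
          exact hterm r (by omega) hs2
        · intro s hs
          obtain ⟨hs1, hs2⟩ := Finset.mem_filter.1 hs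
          have hs1 := Finset.mem_range.1 hs1
          rw [not_le] at hs2
          have hlt : s₀ < s := by exact_mod_cast lt_of_le_of_lt hκ1 hs2
          exact Finset.mem_Ico.2 ⟨hlt, hs1⟩
    _ = B * (q * ∑ i ∈ Finset.range (p + 1 - (s₀ + 1)), (1 / 2 : ℝ) ^ i) := by
        rw [Finset.sum_Ico_eq_sum_range, Finset.mul_sum, Finset.mul_sum]
        refine Finset.sum_congr rfl fun i _ => ?_
        rw [Nat.add_sub_cancel_left]
    _ ≤ B * (q * 2) := by gcongr; exact sum_geometric_two_le _
    _ = _ := by ring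

/-- The relative mass far from the truth is of order `1 / p`. -/
lemma far_bound_le (hA₁ : 0 < A₁) (hA₂ : 0 < A₂) (hp : 1 ≤ p)
    (hprior : IsDimPrior p pr) (h : DimPriorDecay A₁ A₂ A₃ A₄ p pr)
    (hsmall : A₂ * (p : ℝ) ^ (-A₄) ≤ 1 / 2) {κ δ : ℝ}
    (hK : (4 : ℝ) ^ κ * Real.exp 1 / A₁ / p ≤ 1) {s₀ : ℕ} (hs₀ : s₀ ≤ p) :
    (if s₀ = 0 then 0 else (4 : ℝ) ^ (κ * s₀) * Real.exp (-((A₃ + 3) * s₀ * Real.log p)))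
      ≤ 2 * Real.exp (1 / 2 + δ) * ((4 : ℝ) ^ κ * Real.exp 1 / A₁ / p)
        * massLowerBound p pr δ s₀ := by
  have hp0 : (0 : ℝ) < p := by exact_mod_cast hp
  have hpos := hprior.pos hA₁ hA₂ hp h hs₀
  split_ifs with h0
  · unfold massLowerBound
    positivity
  set K := (4 : ℝ) ^ κ * Real.exp 1 / A₁ / p with hKdef
  have hK0 : 0 ≤ K := by positivity
  have hprs : (A₁ * (p : ℝ) ^ (-A₃)) ^ s₀ ≤ 2 * pr s₀ := by
    have h1 := h.pow_le hA₁ hs₀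
    have h2 := hprior.half_le_zero hA₂ h hsmall
    have h3 : (A₁ * (p : ℝ) ^ (-A₃)) ^ s₀ * 1 ≤ (A₁ * (p : ℝ) ^ (-A₃)) ^ s₀ * (2 * pr 0) := by
      gcongr
    linarith
  have hKpow : K ^ s₀ ≤ K := pow_le_of_le_one hK0 hK h0
  -- Of the exponent `A₃ + 3`, the part `A₃` pays for the prior weight of `s₀`, `2` for `(e p²)^s₀`,
  -- and the last unit gives the `1 / p` in `K`.
  have hid : (4 : ℝ) ^ (κ * s₀) * Real.exp (-((A₃ + 3) * s₀ * Real.log p))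
      = K ^ s₀ * (A₁ * (p : ℝ) ^ (-A₃)) ^ s₀ * ((Real.exp 1 * (p : ℝ) ^ 2) ^ s₀)⁻¹ := by
    have h1 : (4 : ℝ) ^ (κ * s₀) = ((4 : ℝ) ^ κ) ^ s₀ := by
      rw [Real.rpow_mul (by norm_num), Real.rpow_natCast]
    have h2 : Real.exp (-((A₃ + 3) * s₀ * Real.log p)) = ((p : ℝ) ^ (-A₃) * (1 / p ^ 3)) ^ s₀ := by
      have h3 : (p : ℝ) ^ (-A₃) * (1 / p ^ 3) = Real.exp (-((A₃ + 3) * Real.log p)) := by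
        rw [Real.rpow_def_of_pos hp0, one_div, ← Real.exp_log (pow_pos hp0 3), ← Real.exp_neg,
          ← Real.exp_add, Real.log_pow]
        congr 1
        push_cast
        ring
      rw [h3, ← Real.exp_nat_mul]
      congr 1
      ring
    rw [h1, h2, ← mul_pow, ← inv_pow, ← mul_pow, ← mul_pow]
    congr 1
    rw [hKdef]
    field_simp
  rw [hid, massLowerBound]
  have hexp : Real.exp (1 / 2 + δ) * Real.exp (-1 / 2 - δ) = 1 := by
    rw [← Real.exp_add]; ring_nf; simp
  calc _ ≤ K * (2 * pr s₀) * ((Real.exp 1 * (p : ℝ) ^ 2) ^ s₀)⁻¹ := by gcongr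
    _ = 2 * (Real.exp (1 / 2 + δ) * Real.exp (-1 / 2 - δ)) * K
        * (pr s₀ * ((Real.exp 1 * (p : ℝ) ^ 2) ^ s₀)⁻¹) := by rw [hexp]; ring
    _ = _ := by ring

end DimPrior

/-! ### The bound for a fixed model sequence index -/

section Bound

variable {A₁ A₂ A₃ A₄ c κ M δ : ℝ}

/-- The relative mass far from the truth. -/
def farError (A₁ κ : ℝ) (p : ℕ) (δ : ℝ) : ℝ :=
  2 * Real.exp (1 / 2 + δ) * ((4 : ℝ) ^ κ * Real.exp 1 / A₁ / p)

/-- The bound on the expected total variation distance. -/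
def tvError (A₁ A₂ A₄ c κ M : ℝ) (p : ℕ) (δ : ℝ) : ℝ :=
  2 / p + Real.exp (49 / 8 * δ / c ^ 2) * Real.exp (1 / 2 + δ) * (2 * dimRatio A₂ A₄ p)
    + farError A₁ κ p δ
    + (Real.exp (M * δ) * (farError A₁ κ p δ + Real.exp (M * δ)) - 1)

/-- Off the noise event the distance is at most one. On it everything is deterministic except the
mass of large models; since the lower bound `D` on the normalizing constant is not random, only the
expectation of the numerator is needed. -/
lemma lintegral_tvDist_le (hA₁ : 0 < A₁) (hA₂ : 0 < A₂) (hA₃ : 0 < A₃) (hA₄ : 0 < A₄)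
    (hc : 0 < c) (hκ : 1 + 3 / A₄ ≤ κ) (hM : 1 ≤ M)
    (hNM : A₃ + 3 + 7 ≤ c ^ 2 * M / (2 * (1 + κ))) (hp : 3 ≤ p) (hlam : 0 < lam)
    (hlam1 : colNorm X / p ≤ lam) (hlam2 : lam ≤ 2 * lamBar X) (hprior : IsDimPrior p pr)
    (hdecay : DimPriorDecay A₁ A₂ A₃ A₄ p pr) (hδ0 : 0 ≤ δ)
    (hδ : (supp b₀).card * lam * Real.sqrt (Real.log p) / colNorm X ≤ δ)
    (hq : dimRatio A₂ A₄ p ≤ 1 / 2) (hsmall : A₂ * (p : ℝ) ^ (-A₄) ≤ 1 / 2)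
    (hK : (4 : ℝ) ^ κ * Real.exp 1 / A₁ / p ≤ 1)
    (hcompat : ENNReal.ofReal c ≤ compat X (supp b₀))
    (hunif : ENNReal.ofReal c ≤ unifCompat X (ENNReal.ofReal ((1 + κ) * (supp b₀).card))) :
    ∫⁻ Y, tvDist (posterior X lam pr Y) (limitPosterior X lam pr κ M b₀ Y) ∂(dataLaw X b₀)
      ≤ ENNReal.ofReal (tvError A₁ A₂ A₄ c κ M p δ) := by
  have hp0 : (0 : ℝ) < p := by exact_mod_cast (by omega : 0 < p)
  have hlog : 1 ≤ Real.log p := by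
    rw [Real.le_log_iff_exp_le hp0]
    have h1 : (3 : ℝ) ≤ p := by exact_mod_cast hp
    linarith [Real.exp_one_lt_d9]
  have hell : 1 ≤ Real.sqrt (Real.log p) := Real.one_le_sqrt.2 hlog
  -- A zero design would give `λ̄ = 0`, against `0 < λ ≤ 2 λ̄`.
  have hx : 0 < colNorm X := by
    rw [lamBar] at hlam2
    by_contra hcon
    have : 2 * colNorm X * Real.sqrt (Real.log p) ≤ 0 :=
      mul_nonpos_of_nonpos_of_nonneg (by linarith) (by linarith)
    linarith
  have hκ1 : 1 ≤ κ := le_trans (by have : 0 < 3 / A₄ := by positivity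
                                   linarith) hκ
  have hpos : ∀ s ≤ p, 0 < pr s := fun s hs => hprior.pos hA₁ hA₂ (by omega) hdecay hs
  set s₀ := (supp b₀).card with hs₀
  have hs₀p : s₀ ≤ p := by simpa using (supp b₀).card_le_univ
  have hmem : supp b₀ ∈ nbhdModels X κ M b₀ := by
    refine Finset.mem_filter.2 ⟨Finset.mem_univ _, ?_, ?_⟩
    · nlinarith [(Nat.cast_nonneg s₀ : (0 : ℝ) ≤ s₀)]
    · have h1 : l1On (supp b₀)ᶜ b₀ = 0 := Finset.sum_eq_zero fun i hi => by
        have : b₀ i = 0 := by simpa [supp] using hi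
        rw [this, abs_zero]
      rw [h1]
      positivity
  have hG : ∀ S ∈ nbhdModels X κ M b₀, (gram X S).PosDef := fun S hS => by
    refine posDef_gram_of_unifCompat hc hx hunif ?_
    have h1 := (Finset.mem_filter.1 hS).2.1
    have h2 : (0 : ℝ) ≤ s₀ := by positivity
    rw [← hs₀] at h1
    linarith
  -- Here `s₀ ≥ 1` and `√(log p) ≥ 1`, the latter from `p ≥ 3`.
  have hratio : s₀ ≠ 0 → lam / colNorm X ≤ δ := fun h0 => by
    refine le_trans ?_ hδ
    have h1 : (1 : ℝ) ≤ s₀ := by exact_mod_cast Nat.one_le_iff_ne_zero.2 h0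
    gcongr
    calc lam = 1 * lam * 1 := by ring
      _ ≤ _ := by gcongr
  have hR : |lam| * (M * s₀ * Real.sqrt (Real.log p) / colNorm X) ≤ M * δ := by
    rw [abs_of_pos hlam]
    calc _ = M * (s₀ * lam * Real.sqrt (Real.log p) / colNorm X) := by ring
      _ ≤ _ := by gcongr
  set D := massLowerBound p pr δ s₀ with hD
  have hDpos : 0 < D := by
    have := hpos s₀ hs₀p
    rw [hD, massLowerBound]
    positivity
  set η := farError A₁ κ p δ with hη
  have hη0 : 0 ≤ η := by rw [hη, farError]; positivity
  have hMδ : 0 ≤ M * δ := by positivity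
  set z := Real.exp (M * δ) * (η + Real.exp (M * δ)) with hz
  have hz1 : 1 ≤ z := by
    have h1 : 1 ≤ Real.exp (M * δ) := Real.one_le_exp hMδ
    rw [hz]
    nlinarith
  have hzE : ENNReal.ofReal (Real.exp (M * δ)) * (ENNReal.ofReal η
      + ENNReal.ofReal (Real.exp (M * δ))) - 1 = ENNReal.ofReal (z - 1) := by
    rw [← ENNReal.ofReal_add hη0 (Real.exp_pos _).le, ← ENNReal.ofReal_mul (Real.exp_pos _).le,
      ENNReal.ofReal_sub _ zero_le_one, ENNReal.ofReal_one]
  set big : EuclideanSpace ℝ (Fin n) → ℝ≥0∞ := fun e =>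
    ∑ S : Finset (Fin p) with ¬ (S.card : ℝ) ≤ κ * s₀,
      ENNReal.ofReal (modelWeight lam pr S) * modelMass X b₀ e lam S Set.univ with hbig
  have hlower : ∀ e : EuclideanSpace ℝ (Fin n), ∀ t, t = 0 ∨ t = lam →
      ENNReal.ofReal D ≤ ENNReal.ofReal (modelWeight lam pr (supp b₀))
        * modelMass X b₀ e t (supp b₀) Set.univ := by
    rintro e t (rfl | rfl)
    · exact massLowerBound_le b₀ e le_rfl hlam.le hx (by omega) hlam1 hδ0 hratio
        (hpos s₀ hs₀p).le
    · exact massLowerBound_le b₀ e hlam.le le_rfl hx (by omega) hlam1 hδ0 hratio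
        (hpos s₀ hs₀p).le
  have hgood : ∀ e ∈ noiseEvent X, tvDist (posterior X lam pr (apply X b₀ + e))
      (limitPosterior X lam pr κ M b₀ (apply X b₀ + e))
      ≤ (ENNReal.ofReal D)⁻¹ * big e + ENNReal.ofReal η + ENNReal.ofReal (z - 1) := by
    intro e he
    rw [← hzE]
    refine tvDist_posterior_limit_le (H := ENNReal.ofReal (η * D)) hlam hpos hG hmem
      (ENNReal.ofReal_pos.2 hDpos).ne' ENNReal.ofReal_ne_top (hlower e) ?_
      (by rw [ENNReal.ofReal_mul hη0]) hR
    intro t ht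
    have ht0 : 0 ≤ t := by rcases ht with rfl | rfl <;> linarith
    have htl : t ≤ 2 * lamBar X := by rcases ht with rfl | rfl <;> linarith
    refine (sum_modelMass_farSet_le hc (by linarith) hM (by linarith : 0 ≤ A₃ + 3) hNM hx
      (by omega) he ht0 htl hlam.le hlam2 hprior hunif).trans (ENNReal.ofReal_le_ofReal ?_)
    exact far_bound_le hA₁ hA₂ (by omega) hprior hdecay hsmall hK hs₀p
  have hbad : ∀ e, tvDist (posterior X lam pr (apply X b₀ + e))
      (limitPosterior X lam pr κ M b₀ (apply X b₀ + e)) ≤ 1 := by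
    intro e
    have hne : ENNReal.ofReal D ≠ 0 := (ENNReal.ofReal_pos.2 hDpos).ne'
    have := isProbabilityMeasure_posterior X b₀ e hlam (fun s hs => (hpos s hs).le) (by
      intro h0
      refine hne (le_antisymm (((hlower e lam (Or.inr rfl)).trans
        (Finset.single_le_sum (f := fun S => ENNReal.ofReal (modelWeight lam pr S)
          * modelMass X b₀ e lam S Set.univ) (fun _ _ => zero_le)
          (Finset.mem_univ _))).trans h0.le) zero_le))
    have := isProbabilityMeasure_limitPosterior X b₀ e hlam hpos hG ⟨_, hmem⟩ (by
      intro h0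
      refine hne (le_antisymm (((hlower e 0 (Or.inl rfl)).trans
        (Finset.single_le_sum (f := fun S => ENNReal.ofReal (modelWeight lam pr S)
          * modelMass X b₀ e 0 S Set.univ) (fun _ _ => zero_le) hmem)).trans h0.le) zero_le))
    exact tvDist_le_one
  have hT := measurableSet_noiseEvent X
  have hbigint : (ENNReal.ofReal D)⁻¹ * ∫⁻ e in noiseEvent X, big e
      ∂(stdGaussian (EuclideanSpace ℝ (Fin n)))
      ≤ ENNReal.ofReal (Real.exp (49 / 8 * δ / c ^ 2) * Real.exp (1 / 2 + δ)
        * (2 * dimRatio A₂ A₄ p)) := by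
    rw [mul_comm, ← div_eq_mul_inv]
    refine ENNReal.div_le_of_le_mul ?_
    refine (lintegral_sum_modelMass_le hc hx (by omega) hlam hlam2 hδ0 hδ hcompat
      (fun s hs => (hpos s hs).le) (κ * s₀)).trans ?_
    rw [← ENNReal.ofReal_mul (by unfold dimRatio; positivity)]
    refine ENNReal.ofReal_le_ofReal ?_
    have h1 := sum_large_le hA₂ hA₄ (by omega) (fun s hs => (hpos s hs).le) hdecay hq hκ hs₀p
    have hexp : Real.exp (1 / 2 + δ) * Real.exp (-1 / 2 - δ) = 1 := by
      rw [← Real.exp_add]; ring_nf; simp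
    calc _ ≤ Real.exp (49 / 8 * δ / c ^ 2) * (2 * dimRatio A₂ A₄ p
          * (pr s₀ * ((Real.exp 1 * (p : ℝ) ^ 2) ^ s₀)⁻¹)) := by gcongr
      _ = Real.exp (49 / 8 * δ / c ^ 2) * (Real.exp (1 / 2 + δ) * Real.exp (-1 / 2 - δ))
          * (2 * dimRatio A₂ A₄ p) * (pr s₀ * ((Real.exp 1 * (p : ℝ) ^ 2) ^ s₀)⁻¹) := by
          rw [hexp]; ring
      _ = _ := by rw [hD, massLowerBound]; ring
  -- A translation is a measurable embedding, so the change of variables needs no measurability of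
  -- the total variation distance in `Y`.
  rw [dataLaw_eq_map, (measurableEmbedding_addLeft (apply X b₀)).lintegral_map]
  calc _ ≤ ∫⁻ e, ((noiseEvent X)ᶜ.indicator 1 e + (ENNReal.ofReal η + ENNReal.ofReal (z - 1))
        + (noiseEvent X).indicator (fun e => (ENNReal.ofReal D)⁻¹ * big e) e)
        ∂(stdGaussian (EuclideanSpace ℝ (Fin n))) := by
        refine lintegral_mono fun e => ?_
        by_cases he : e ∈ noiseEvent X
        · refine (hgood e he).trans (le_of_eq ?_)
          simp only [Set.indicator_of_mem he, Set.mem_compl_iff, he, not_true_eq_false,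
            not_false_eq_true, Set.indicator_of_notMem, zero_add]
          ring
        · refine (hbad e).trans ?_
          rw [Set.indicator_of_mem (show e ∈ (noiseEvent X)ᶜ from he), Pi.one_apply, add_assoc]
          exact le_self_add
    _ = stdGaussian (EuclideanSpace ℝ (Fin n)) (noiseEvent X)ᶜ
        + (ENNReal.ofReal η + ENNReal.ofReal (z - 1))
        + (ENNReal.ofReal D)⁻¹ * ∫⁻ e in noiseEvent X, big e
          ∂(stdGaussian (EuclideanSpace ℝ (Fin n))) := by
        rw [lintegral_add_left ((measurable_one.indicator hT.compl).add_const _),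
          lintegral_add_left (measurable_one.indicator hT.compl), lintegral_const, measure_univ,
          mul_one, lintegral_indicator_one hT.compl, lintegral_indicator hT,
          lintegral_const_mul' _ _ (ENNReal.inv_ne_top.2 (ENNReal.ofReal_pos.2 hDpos).ne')]
    _ ≤ ENNReal.ofReal (2 / p) + (ENNReal.ofReal η + ENNReal.ofReal (z - 1))
        + ENNReal.ofReal (Real.exp (49 / 8 * δ / c ^ 2) * Real.exp (1 / 2 + δ)
        * (2 * dimRatio A₂ A₄ p)) := by
        gcongr
        exact stdGaussian_noiseEvent_compl_le hx (by omega)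
    _ = _ := by
        have hdim0 : 0 ≤ Real.exp (49 / 8 * δ / c ^ 2) * Real.exp (1 / 2 + δ)
            * (2 * dimRatio A₂ A₄ p) := by unfold dimRatio; positivity
        rw [← ENNReal.ofReal_add hη0 (by linarith), ← ENNReal.ofReal_add (by positivity)
          (by linarith), ← ENNReal.ofReal_add (add_nonneg (by positivity) (by linarith)) hdim0,
          tvError]
        congr 1
        ring

end Bound

/-! ### Limits of the error terms -/

section Limits

variable {p : ℕ → ℕ} {δ : ℕ → ℝ}

lemma tendsto_natCast_rpow_neg {a : ℝ} (ha : 0 < a) (hp : Tendsto p atTop atTop) :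
    Tendsto (fun k => (p k : ℝ) ^ (-a)) atTop (𝓝 0) :=
  (tendsto_rpow_neg_atTop ha).comp (tendsto_natCast_atTop_atTop.comp hp)

/-- The powers of `p` combine to `-A₄ + 2 A₄ / 3 = -A₄ / 3`. -/
lemma tendsto_dimRatio {A₂ A₄ : ℝ} (hA₄ : 0 < A₄) (hp : Tendsto p atTop atTop) :
    Tendsto (fun k => dimRatio A₂ A₄ (p k)) atTop (𝓝 0) := by
  have h := (tendsto_natCast_rpow_neg (a := A₄ / 3) (by positivity) hp).const_mul
    (A₂ * 4 * (4 * Real.exp 1) ^ (A₄ / 3))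
  rw [mul_zero] at h
  refine h.congr' ?_
  filter_upwards [hp.eventually_ge_atTop 1] with k hk
  have hp0 : (0 : ℝ) < p k := by exact_mod_cast hk
  have h1 : (p k : ℝ) ^ (-(A₄ / 3)) = (p k : ℝ) ^ (-A₄) * ((p k : ℝ) ^ 2) ^ (A₄ / 3) := by
    rw [← Real.rpow_natCast (p k : ℝ) 2, ← Real.rpow_mul hp0.le, ← Real.rpow_add hp0]
    congr 1
    push_cast
    ring
  rw [dimRatio, h1, ← mul_assoc 4, Real.mul_rpow (x := 4 * Real.exp 1) (by positivity) (by positivity)]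
  ring

lemma tendsto_const_div_natCast (C : ℝ) (hp : Tendsto p atTop atTop) :
    Tendsto (fun k => C / (p k : ℝ)) atTop (𝓝 0) :=
  (tendsto_const_div_atTop_nhds_zero_nat C).comp hp

lemma tendsto_tvError {A₁ A₂ A₄ c κ M : ℝ} (hA₄ : 0 < A₄) (hp : Tendsto p atTop atTop)
    (hδ : Tendsto δ atTop (𝓝 0)) :
    Tendsto (fun k => tvError A₁ A₂ A₄ c κ M (p k) (δ k)) atTop (𝓝 0) := by
  have h1 := tendsto_const_div_natCast 2 hp
  have h2 := (tendsto_dimRatio (A₂ := A₂) hA₄ hp).const_mul 2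
  have hexp : ∀ f : ℝ → ℝ, Continuous f →
      Tendsto (fun k => Real.exp (f (δ k))) atTop (𝓝 (Real.exp (f 0))) := fun f hf =>
    ((Real.continuous_exp.comp hf).tendsto 0).comp hδ
  have h3 := hexp (fun x => 49 / 8 * x / c ^ 2) (by fun_prop)
  have h4 := hexp (fun x => 1 / 2 + x) (by fun_prop)
  have h5 := hexp (fun x => M * x) (by fun_prop)
  have h6 := tendsto_const_div_natCast ((4 : ℝ) ^ κ * Real.exp 1 / A₁) hp
  have h7 := (h4.const_mul 2).mul h6
  have h8 := ((h1.add ((h3.mul h4).mul h2)).add h7).add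
    ((h5.mul (h7.add h5)).sub_const 1)
  simpa [tvError, farError] using h8

end Limits

end

end SparseRegression

end

theorem theorem6
    (A₁ A₂ A₃ A₄ : ℝ) (hA₁ : 0 < A₁) (hA₂ : 0 < A₂) (hA₃ : 0 < A₃) (hA₄ : 0 < A₄)
    (c₀ : ℝ) (hc₀ : 0 < c₀) (κ : ℝ) (hκ : 1 + 3 / A₄ ≤ κ) :
    ∃ M₀ : ℝ, ∀ M : ℝ, M₀ ≤ M →
      ∀ (n p : ℕ → ℕ) (X : ∀ k, Matrix (Fin (n k)) (Fin (p k)) ℝ)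
        (lam : ℕ → ℝ) (pr : ℕ → ℕ → ℝ) (s : ℕ → ℝ),
        Tendsto p atTop atTop →
        (∀ k, 0 < lam k) →
        (∀ k, SparseRegression.colNorm (X k) / (p k : ℝ) ≤ lam k ∧
          lam k ≤ 2 * SparseRegression.lamBar (X k)) →
        (∀ k, SparseRegression.IsDimPrior (p k) (pr k)) →
        (∀ k, SparseRegression.DimPriorDecay A₁ A₂ A₃ A₄ (p k) (pr k)) →
        Tendsto (fun k => s k * lam k * Real.sqrt (Real.log (p k))
          / SparseRegression.colNorm (X k)) atTop (𝓝 0) →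
        Tendsto (fun k =>
          ⨆ (b₀ : EuclideanSpace ℝ (Fin (p k)))
            (_ : ENNReal.ofReal c₀ ≤ SparseRegression.compat (X k) (SparseRegression.supp b₀) ∧
              ((SparseRegression.supp b₀).card : ℝ) ≤ s k ∧
              ENNReal.ofReal c₀ ≤
                SparseRegression.psiBar (X k) A₄ (lam k) (SparseRegression.supp b₀) ∧
              ENNReal.ofReal c₀ ≤ SparseRegression.unifCompat (X k)
                (ENNReal.ofReal ((1 + κ) * (SparseRegression.supp b₀).card))),
            ∫⁻ Y, SparseRegression.tvDist
                (SparseRegression.posterior (X k) (lam k) (pr k) Y)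
                (SparseRegression.limitPosterior (X k) (lam k) (pr k) κ M b₀ Y)
              ∂(SparseRegression.dataLaw (X k) b₀))
          atTop (𝓝 0) := by
  have hκ1 : 1 ≤ κ := le_trans (by have : 0 < 3 / A₄ := by positivity
                                   linarith) hκ
  -- The threshold solves `N + 7 ≤ c₀² M / (2 (1 + κ))` for `N = A₃ + 3`.
  refine ⟨max 1 ((A₃ + 3 + 7) * (2 * (1 + κ)) / c₀ ^ 2), fun M hM n p X lam pr s hp hlam hlam12
    hprior hdecay hs => ?_⟩
  have hM1 : 1 ≤ M := (le_max_left _ _).trans hM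
  have hNM : A₃ + 3 + 7 ≤ c₀ ^ 2 * M / (2 * (1 + κ)) := by
    have h := (le_max_right _ _).trans hM
    rw [div_le_iff₀ (by positivity)] at h
    rw [le_div_iff₀ (by positivity)]
    linarith
  -- The absolute value keeps `δ` nonnegative even where `s k < 0`. The error depends on `b₀` only
  -- through `δ`, which gives uniformity.
  set δ : ℕ → ℝ := fun k =>
    |s k * lam k * Real.sqrt (Real.log (p k)) / SparseRegression.colNorm (X k)| with hδdef
  have hδ : Tendsto δ atTop (𝓝 0) := by simpa using hs.abs
  have herr := SparseRegression.tendsto_tvError (A₁ := A₁) (A₂ := A₂) (c := c₀) (κ := κ) (M := M)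
    hA₄ hp hδ
  have hlim := ENNReal.tendsto_ofReal herr
  rw [ENNReal.ofReal_zero] at hlim
  refine tendsto_of_tendsto_of_tendsto_of_le_of_le' tendsto_const_nhds hlim
    (Eventually.of_forall fun _ => zero_le) ?_
  have hq := (SparseRegression.tendsto_dimRatio (A₂ := A₂) hA₄ hp).eventually_le_const
    (show (0 : ℝ) < 1 / 2 by norm_num)
  have hsmall := ((SparseRegression.tendsto_natCast_rpow_neg hA₄ hp).const_mul A₂)
  rw [mul_zero] at hsmall
  have hK := (SparseRegression.tendsto_const_div_natCast
    ((4 : ℝ) ^ κ * Real.exp 1 / A₁) hp).eventually_le_const (show (0 : ℝ) < 1 by norm_num)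
  filter_upwards [hq, hsmall.eventually_le_const (show (0 : ℝ) < 1 / 2 by norm_num), hK,
    hp.eventually_ge_atTop 3] with k hqk hsk hKk hpk
  refine iSup₂_le fun b₀ ⟨hcompat, hcard, _, hunif⟩ => ?_
  have hx : 0 ≤ SparseRegression.colNorm (X k) := Real.iSup_nonneg fun j => Real.sqrt_nonneg _
  refine SparseRegression.lintegral_tvDist_le hA₁ hA₂ hA₃ hA₄ hc₀ hκ hM1 hNM hpk (hlam k)
    (hlam12 k).1 (hlam12 k).2 (hprior k) (hdecay k) (abs_nonneg _) ?_ hqk hsk hKk hcompat hunif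
  refine le_trans ?_ (le_abs_self _)
  have := hlam k
  gcongr
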